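/- **Definitions.** Let $M$ be a (Hausdorff, second countable) smooth manifold of dimension $2n+1$ with $n\ge 1$. A *para-contact metric structure* $(\phi,\xi,\eta,g)$ on $M$ consists of a contact form $\eta$ (that is, $\eta\wedge(d\eta)^n$ vanishes nowhere) with Reeb vector field $\xi$ (that is, $\eta(\xi)=1$ and $d\eta(\xi,\cdot)=0$), a $(1,1)$-tensor field $\phi$ and a semi-Riemannian metric $g$ such that $$\phi^2=\mathrm{Id}-\eta\otimes\xi,\qquad g(\phi X,\phi Y)=-g(X,Y)+\eta(X)\eta(Y),\qquad d\eta(X,Y)=g(X,\phi Y),$$ and such that on each fibre of $\ker\eta$ the eigenspaces of $\phi$ for $+1$ and $-1$ are both $n$-dimensional. Here $d\eta(X,Y)=\tfrac12\big(X(\eta(Y))-Y(\eta(X))-\eta([X,Y])\big)$. The structure is *para-Sasakian* if $$\phi^2[X,Y]+[\phi X,\phi Y]-\phi[\phi X,Y]-\phi[X,\phi Y]-2\,d\eta(X,Y)\,\xi=0$$ for all vector fields $X,Y$. A *$\phi$-geodesic* is a geodesic $\gamma$ of $g$ with $\eta(\gamma'(t))=0$ for all $t$. A *$\phi$-geodesic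 symmetry* at $x\in M$ is a local diffeomorphism $\sigma$, defined on an open neighbourhood of $x$, such that for every $\phi$-geodesic $\gamma$ with $\gamma(0)$ on the trajectory of $\xi$ through $x$ one has $\sigma(\gamma(s))=\gamma(-s)$ whenever $\gamma$ is defined on an open interval that is symmetric about $0$ and contains $s$, and $\gamma(s)$ is in the domain of $\sigma$. A para-Sasakian manifold is a *(globally) $\phi$-symmetric space* if at every point $x$ there is a $\phi$-geodesic symmetry, every $\phi$-geodesic symmetry $\sigma$ at $x$ is extendable to a global automorphism (a diffeomorphism of $M$ preserving $\phi,\xi,\eta,g$ that coincides with $\sigma$ near $x$), and the vector field $\xi$ is complete, i.e. generates a $1$-parameter group of global transformations. **Theorem.** Let $(M,\phi,\xi,\eta,g)$ be a connected para-Sasakian $\phi$-symmetric space of dimension $2n+1\ge 3$, and let $\mathrm{Iso}(M)$ be the group of isometries of $(M,g)$ with its Lie group topology (the compact-open topology). Let $G$ be the closure in $\mathrm{Iso}(M)$ of the subgroup generated by all the $\phi$-geodesic symmetries of $M$ (extended to global automorphisms). Then $G$ acts transitively on $M$: for all $p,q\in M$ there is $F\in G$ with $F(p)=q$. -/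

import Mathlib

open scoped Manifold ContDiff Topology
open Bundle

noncomputable section

namespace ParaSasaki

section SemiRiemannian

variable {d : ℕ} {M : Type*} [TopologicalSpace M] [ChartedSpace (EuclideanSpace ℝ (Fin d)) M]
  [IsManifold (𝓡 d) ∞ M]

/-- The smooth vector fields on a `d`-dimensional manifold. -/
def IsSmoothVectorField (X : Π x : M, TangentSpace (𝓡 d) x) : Prop :=
  ContMDiff (𝓡 d) (𝓡 d).tangent ∞ (fun x => (⟨x, X x⟩ : TangentBundle (𝓡 d) M))

variable (d M) in
/-- A semi-Riemannian metric: a smooth field of symmetric nondegenerate bilinear forms. -/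
structure SemiRiemannianMetric where
  /-- The bilinear form on each tangent space. -/
  val (x : M) : TangentSpace (𝓡 d) x →L[ℝ] TangentSpace (𝓡 d) x →L[ℝ] ℝ
  symm (x : M) (v w : TangentSpace (𝓡 d) x) : val x v w = val x w v
  nondegenerate (x : M) (v : TangentSpace (𝓡 d) x) (h : ∀ w, val x v w = 0) : v = 0
  contMDiff : ContMDiff (𝓡 d)
    ((𝓡 d).prod 𝓘(ℝ, EuclideanSpace ℝ (Fin d) →L[ℝ] EuclideanSpace ℝ (Fin d) →L[ℝ] ℝ)) ∞
    (fun x => TotalSpace.mk'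
      (EuclideanSpace ℝ (Fin d) →L[ℝ] EuclideanSpace ℝ (Fin d) →L[ℝ] ℝ)
      (E := fun x : M => TangentSpace (𝓡 d) x →L[ℝ] TangentSpace (𝓡 d) x →L[ℝ] ℝ) x (val x))

namespace SemiRiemannianMetric

variable (g : SemiRiemannianMetric d M)

/-- The matrix of the metric in the chart at `p`: for `y` in the image of the chart and
`v, w ∈ ℝ^d`, the number `g(dψ⁻¹ v, dψ⁻¹ w)` at the point `ψ⁻¹ y`, where `ψ` is the chart. -/
def inChart (p : M) (y v w : EuclideanSpace ℝ (Fin d)) : ℝ :=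
  g.val ((extChartAt (𝓡 d) p).symm y)
    (mfderiv 𝓘(ℝ, EuclideanSpace ℝ (Fin d)) (𝓡 d) (extChartAt (𝓡 d) p).symm y v)
    (mfderiv 𝓘(ℝ, EuclideanSpace ℝ (Fin d)) (𝓡 d) (extChartAt (𝓡 d) p).symm y w)

/-- The Christoffel symbols of the first kind of the Levi-Civita connection in the chart at `p`:
`⟨Γ_y(u, v), w⟩ = ½ (∂_u g(v, w) + ∂_v g(u, w) - ∂_w g(u, v))`. -/
def christoffel (p : M) (y u v w : EuclideanSpace ℝ (Fin d)) : ℝ :=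
  (1 / 2) * (fderiv ℝ (fun z => g.inChart p z v w) y u
    + fderiv ℝ (fun z => g.inChart p z u w) y v
    - fderiv ℝ (fun z => g.inChart p z u v) y w)

/-- `γ` is a geodesic of the Levi-Civita connection on the open set `J` of times: in every chart
it satisfies `γ'' + Γ(γ', γ') = 0`, here with the free index lowered (the metric being
nondegenerate). Solutions of class `C^2` are automatically smooth. -/
def IsGeodesicOn (γ : ℝ → M) (J : Set ℝ) : Prop :=
  ContMDiffOn 𝓘(ℝ, ℝ) (𝓡 d) 2 γ J ∧
  ∀ t ∈ J, ∀ p : M, γ t ∈ (chartAt (EuclideanSpace ℝ (Fin d)) p).source →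
    ∀ w : EuclideanSpace ℝ (Fin d),
      g.inChart p (extChartAt (𝓡 d) p (γ t))
          (deriv (deriv fun s => extChartAt (𝓡 d) p (γ s)) t) w
        + g.christoffel p (extChartAt (𝓡 d) p (γ t))
          (deriv (fun s => extChartAt (𝓡 d) p (γ s)) t)
          (deriv (fun s => extChartAt (𝓡 d) p (γ s)) t) w = 0

/-- The group `Iso(M)` of isometries: the diffeomorphisms `F` of `M` with `F^* g = g`. -/
def isometryGroup : Subgroup (M ≃ₜ M) where
  carrier := {F | ContMDiff (𝓡 d) (𝓡 d) ∞ F ∧ ContMDiff (𝓡 d) (𝓡 d) ∞ F.symm ∧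
    ∀ (x : M) (v w : TangentSpace (𝓡 d) x),
      g.val (F x) (mfderiv (𝓡 d) (𝓡 d) F x v) (mfderiv (𝓡 d) (𝓡 d) F x w) = g.val x v w}
  mul_mem' := by
    rintro F F' ⟨h1, h2, h3⟩ ⟨k1, k2, k3⟩
    refine ⟨h1.comp k1, k2.comp h2, fun x v w => ?_⟩
    have hc : mfderiv (𝓡 d) (𝓡 d) (⇑(F * F')) x
        = (mfderiv (𝓡 d) (𝓡 d) F (F' x)).comp (mfderiv (𝓡 d) (𝓡 d) F' x) :=
      mfderiv_comp x (h1.mdifferentiable (by simp) _) (k1.mdifferentiable (by simp) _)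
    rw [hc]
    exact (h3 _ _ _).trans (k3 _ _ _)
  one_mem' := by
    refine ⟨contMDiff_id, contMDiff_id, fun x v w => ?_⟩
    have hc : mfderiv (𝓡 d) (𝓡 d) (⇑(1 : M ≃ₜ M)) x
        = ContinuousLinearMap.id ℝ (TangentSpace (𝓡 d) x) := mfderiv_id
    rw [hc]
    rfl
  inv_mem' := by
    rintro F ⟨h1, h2, h3⟩
    refine ⟨h2, h1, fun x v w => ?_⟩
    have hinv : ∀ u : TangentSpace (𝓡 d) x,
        mfderiv (𝓡 d) (𝓡 d) F (F.symm x) (mfderiv (𝓡 d) (𝓡 d) F.symm x u) = u := by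
      intro u
      have hc := mfderiv_comp x (h1.mdifferentiable (by simp) (F.symm x))
        (h2.mdifferentiable (by simp) x)
      have hid : (F ∘ F.symm : M → M) = id := by
        funext y
        simp
      rw [hid, mfderiv_id] at hc
      exact (congrArg (fun L => L u) hc).symm
    have key := h3 (F.symm x) (mfderiv (𝓡 d) (𝓡 d) F.symm x v) (mfderiv (𝓡 d) (𝓡 d) F.symm x w)
    have e : F (F.symm x) = x := F.apply_symm_apply x
    change g.val (F.symm x) (mfderiv (𝓡 d) (𝓡 d) F.symm x v)
      (mfderiv (𝓡 d) (𝓡 d) F.symm x w) = g.val x v w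
    rw [← key]
    erw [hinv v, hinv w]
    rw [e]

/-- A pair consisting of an isometry and its inverse, as continuous maps. -/
def isometryToPair (F : g.isometryGroup) : C(M, M) × C(M, M) :=
  (⟨(F : M ≃ₜ M), (F : M ≃ₜ M).continuous⟩, ⟨(F : M ≃ₜ M).symm, (F : M ≃ₜ M).symm.continuous⟩)

/-- `Iso(M)` carries the compact-open topology (for the isometries and their inverses), which
is the topology of its standard Lie group structure. -/
instance : TopologicalSpace g.isometryGroup :=
  TopologicalSpace.induced g.isometryToPair inferInstance

instance : IsTopologicalGroup g.isometryGroup := by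
  have : LocallyCompactSpace M := ChartedSpace.locallyCompactSpace (EuclideanSpace ℝ (Fin d)) M
  have hind : Continuous g.isometryToPair := continuous_induced_dom
  have h1 : Continuous fun F : g.isometryGroup => (g.isometryToPair F).1 := continuous_fst.comp hind
  have h2 : Continuous fun F : g.isometryGroup => (g.isometryToPair F).2 := continuous_snd.comp hind
  refine { continuous_mul := ?_, continuous_inv := ?_ }
  · refine continuous_induced_rng.2 (Continuous.prodMk ?_ ?_)
    · exact (h1.comp continuous_fst).compCM (h1.comp continuous_snd)
    · exact (h2.comp continuous_snd).compCM (h2.comp continuous_fst)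
  · exact continuous_induced_rng.2 (Continuous.prodMk h2 h1)

end SemiRiemannianMetric

end SemiRiemannian

section ParaContact

variable {n : ℕ} {M : Type*} [TopologicalSpace M]
  [ChartedSpace (EuclideanSpace ℝ (Fin (2 * n + 1))) M] [IsManifold (𝓡 (2 * n + 1)) ∞ M]

/-- The exterior derivative of a `1`-form evaluated on vector fields, with the convention
`dη(X, Y) = ½ (X(η(Y)) - Y(η(X)) - η([X, Y]))`. -/
def extDerivOneForm (η : Π x : M, TangentSpace (𝓡 (2 * n + 1)) x →L[ℝ] ℝ)
    (X Y : Π x : M, TangentSpace (𝓡 (2 * n + 1)) x) (x : M) : ℝ :=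
  (1 / 2) * (mvfderiv (𝓡 (2 * n + 1)) (fun y => η y (Y y)) x (X x)
    - mvfderiv (𝓡 (2 * n + 1)) (fun y => η y (X y)) x (Y x)
    - η x (VectorField.mlieBracket (𝓡 (2 * n + 1)) X Y x))

/-- The form `η ∧ (dη)^n`, up to a nonzero constant factor, evaluated on vector fields: the
antisymmetrization of `η(V_0) dη(V_1, V_2) ⋯ dη(V_{2n-1}, V_{2n})`. -/
def contactVolume (η : Π x : M, TangentSpace (𝓡 (2 * n + 1)) x →L[ℝ] ℝ)
    (V : Fin (2 * n + 1) → Π x : M, TangentSpace (𝓡 (2 * n + 1)) x) (x : M) : ℝ :=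
  ∑ s : Equiv.Perm (Fin (2 * n + 1)), ((Equiv.Perm.sign s : ℤ) : ℝ) *
    (η x (V (s 0) x) * ∏ i : Fin n,
      extDerivOneForm η (V (s ⟨2 * i + 1, by omega⟩)) (V (s ⟨2 * i + 2, by omega⟩)) x)

variable (n M) in
/-- A para-contact metric structure `(φ, ξ, η, g)` on a `(2n+1)`-dimensional manifold. -/
structure ParaContactMetricStructure where
  /-- The `(1,1)`-tensor. -/
  φ (x : M) : TangentSpace (𝓡 (2 * n + 1)) x →L[ℝ] TangentSpace (𝓡 (2 * n + 1)) x
  /-- The Reeb vector field. -/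
  ξ (x : M) : TangentSpace (𝓡 (2 * n + 1)) x
  /-- The contact form. -/
  η (x : M) : TangentSpace (𝓡 (2 * n + 1)) x →L[ℝ] ℝ
  /-- The semi-Riemannian metric. -/
  g : SemiRiemannianMetric (2 * n + 1) M
  contMDiff_φ : ContMDiff (𝓡 (2 * n + 1)) ((𝓡 (2 * n + 1)).prod
      𝓘(ℝ, EuclideanSpace ℝ (Fin (2 * n + 1)) →L[ℝ] EuclideanSpace ℝ (Fin (2 * n + 1)))) ∞
    (fun x => TotalSpace.mk'
      (EuclideanSpace ℝ (Fin (2 * n + 1)) →L[ℝ] EuclideanSpace ℝ (Fin (2 * n + 1)))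
      (E := fun x : M =>
        TangentSpace (𝓡 (2 * n + 1)) x →L[ℝ] TangentSpace (𝓡 (2 * n + 1)) x) x (φ x))
  contMDiff_ξ : IsSmoothVectorField ξ
  contMDiff_η : ContMDiff (𝓡 (2 * n + 1))
      ((𝓡 (2 * n + 1)).prod 𝓘(ℝ, EuclideanSpace ℝ (Fin (2 * n + 1)) →L[ℝ] ℝ)) ∞
    (fun x => TotalSpace.mk' (EuclideanSpace ℝ (Fin (2 * n + 1)) →L[ℝ] ℝ)
      (E := fun x : M => TangentSpace (𝓡 (2 * n + 1)) x →L[ℝ] ℝ) x (η x))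
  /-- `η` is a contact form: `η ∧ (dη)^n` vanishes nowhere. -/
  contact (x : M) : ∃ V : Fin (2 * n + 1) → Π x : M, TangentSpace (𝓡 (2 * n + 1)) x,
    (∀ i, IsSmoothVectorField (V i)) ∧ contactVolume η V x ≠ 0
  /-- `ξ` is the Reeb vector field: `η(ξ) = 1` and `ξ` lies in the kernel of `dη`. -/
  η_ξ (x : M) : η x (ξ x) = 1
  dη_ξ (X : Π x : M, TangentSpace (𝓡 (2 * n + 1)) x) (hX : IsSmoothVectorField X) (x : M) :
    extDerivOneForm η ξ X x = 0
  φ_sq (x : M) (v : TangentSpace (𝓡 (2 * n + 1)) x) : φ x (φ x v) = v - η x v • ξ x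
  g_φ (x : M) (v w : TangentSpace (𝓡 (2 * n + 1)) x) :
    g.val x (φ x v) (φ x w) = - g.val x v w + η x v * η x w
  dη_eq (X Y : Π x : M, TangentSpace (𝓡 (2 * n + 1)) x) (hX : IsSmoothVectorField X)
    (hY : IsSmoothVectorField Y) (x : M) : extDerivOneForm η X Y x = g.val x (X x) (φ x (Y x))
  /-- On every fibre of the horizontal distribution `ker η`, the two eigenspaces of `φ` for
  the eigenvalues `1` and `-1` are `n`-dimensional. -/
  finrank_pos (x : M) : Module.finrank ℝ
    ↥((η x).toLinearMap.ker ⊓ Module.End.eigenspace (φ x).toLinearMap 1) = n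
  finrank_neg (x : M) : Module.finrank ℝ
    ↥((η x).toLinearMap.ker ⊓ Module.End.eigenspace (φ x).toLinearMap (-1)) = n

namespace ParaContactMetricStructure

variable (S : ParaContactMetricStructure n M)

/-- The Nijenhuis tensor `φ²[X, Y] + [φX, φY] - φ[φX, Y] - φ[X, φY]`. -/
def nijenhuis (X Y : Π x : M, TangentSpace (𝓡 (2 * n + 1)) x) (x : M) :
    TangentSpace (𝓡 (2 * n + 1)) x :=
  S.φ x (S.φ x (VectorField.mlieBracket (𝓡 (2 * n + 1)) X Y x))
    + VectorField.mlieBracket (𝓡 (2 * n + 1)) (fun y => S.φ y (X y)) (fun y => S.φ y (Y y)) x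
    - S.φ x (VectorField.mlieBracket (𝓡 (2 * n + 1)) (fun y => S.φ y (X y)) Y x)
    - S.φ x (VectorField.mlieBracket (𝓡 (2 * n + 1)) X (fun y => S.φ y (Y y)) x)

/-- A para-contact metric structure is para-Sasakian if `N_φ(X, Y) - 2 dη(X, Y) ξ = 0`. -/
def IsParaSasakian : Prop :=
  ∀ X Y : Π x : M, TangentSpace (𝓡 (2 * n + 1)) x,
    IsSmoothVectorField X → IsSmoothVectorField Y →
    ∀ x, S.nijenhuis X Y x - (2 * extDerivOneForm S.η X Y x) • S.ξ x = 0

/-- A `φ`-geodesic: a geodesic whose velocity satisfies `η(γ') = 0` at all times. -/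
def IsPhiGeodesicOn (γ : ℝ → M) (J : Set ℝ) : Prop :=
  S.g.IsGeodesicOn γ J ∧
  ∀ t ∈ J, S.η (γ t) (mfderiv 𝓘(ℝ, ℝ) (𝓡 (2 * n + 1)) γ t (1 : ℝ)) = 0

/-- The trajectory through `x` of the (maximal) integral curve of `ξ`. -/
def reebTrajectory (x : M) : Set M :=
  {y | ∃ (c : ℝ → M) (J : Set ℝ) (t : ℝ), IsOpen J ∧ J.OrdConnected ∧ 0 ∈ J ∧ t ∈ J ∧
    IsMIntegralCurveOn c S.ξ J ∧ c 0 = x ∧ c t = y}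

/-- `σ` is a `φ`-geodesic symmetry at `x`: a local diffeomorphism, defined on the open
neighbourhood `σ.source` of `x`, such that `σ (γ s) = γ (-s)` whenever `γ s` is in the domain
of `σ`, for every `φ`-geodesic `γ` with `γ 0` on the trajectory of `ξ` through `x`. -/
def IsPhiGeodesicSymmetry (σ : OpenPartialHomeomorph M M) (x : M) : Prop :=
  x ∈ σ.source ∧
  ContMDiffOn (𝓡 (2 * n + 1)) (𝓡 (2 * n + 1)) ∞ σ σ.source ∧
  ContMDiffOn (𝓡 (2 * n + 1)) (𝓡 (2 * n + 1)) ∞ σ.symm σ.target ∧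
  ∀ (γ : ℝ → M) (a : ℝ), 0 < a → S.IsPhiGeodesicOn γ (Set.Ioo (-a) a) →
    γ 0 ∈ S.reebTrajectory x →
    ∀ s ∈ Set.Ioo (-a) a, γ s ∈ σ.source → σ (γ s) = γ (-s)

/-- Global automorphisms of the para-contact metric structure: diffeomorphisms that preserve
`φ`, `ξ`, `η` and `g`. -/
def IsAutomorphism (F : M ≃ₜ M) : Prop :=
  F ∈ S.g.isometryGroup ∧
  (∀ (x : M) (v : TangentSpace (𝓡 (2 * n + 1)) x),
    mfderiv (𝓡 (2 * n + 1)) (𝓡 (2 * n + 1)) F x (S.φ x v)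
      = S.φ (F x) (mfderiv (𝓡 (2 * n + 1)) (𝓡 (2 * n + 1)) F x v)) ∧
  (∀ x : M, mfderiv (𝓡 (2 * n + 1)) (𝓡 (2 * n + 1)) F x (S.ξ x) = S.ξ (F x)) ∧
  (∀ (x : M) (v : TangentSpace (𝓡 (2 * n + 1)) x),
    S.η (F x) (mfderiv (𝓡 (2 * n + 1)) (𝓡 (2 * n + 1)) F x v) = S.η x v)

/-- `F` is a global automorphism that extends (the germ at `x` of) `σ`. -/
def IsAutomorphicExtension (F : M ≃ₜ M) (σ : OpenPartialHomeomorph M M) (x : M) : Prop :=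
  S.IsAutomorphism F ∧ ∀ᶠ y in 𝓝 x, F y = σ y

/-- A para-Sasakian `φ`-symmetric space: there is a `φ`-geodesic symmetry at every point,
every `φ`-geodesic symmetry extends to a global automorphism, and `ξ` is complete, that is, it
generates a `1`-parameter group of global transformations. -/
structure IsPhiSymmetric : Prop where
  paraSasakian : S.IsParaSasakian
  exists_symmetry : ∀ x, ∃ σ, S.IsPhiGeodesicSymmetry σ x
  extendable : ∀ x σ, S.IsPhiGeodesicSymmetry σ x → ∃ F, S.IsAutomorphicExtension F σ x
  complete : ∀ x, ∃ c : ℝ → M, c 0 = x ∧ IsMIntegralCurve c S.ξ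

/-- The `φ`-geodesic symmetries of `M`, as elements of `Iso(M)`. -/
def phiSymmetries : Set S.g.isometryGroup :=
  {F | ∃ x σ, S.IsPhiGeodesicSymmetry σ x ∧ S.IsAutomorphicExtension F σ x}

end ParaContactMetricStructure

end ParaContact

end ParaSasaki

end

/-!
Let `H` be the group generated by the `φ`-geodesic symmetries. Already `H` itself is transitive;
the closure is not needed. Call two points related if they lie in the same `H`-orbit.

*Moving along `φ`-geodesics.* The Reeb field of a para-Sasakian structure is a Killing field
(`killing_of_paraSasakian`), so `g(γ', ξ) = η(γ')` is constant along geodesics, and a geodesic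
that starts in `ker η` is a `φ`-geodesic (`isPhiGeodesicOn_of_horizontal`). The automorphism
extending the symmetry at the midpoint of a `φ`-geodesic segment exchanges the end points of the
segment (`exists_mem_phiSymmetries_of_isPhiGeodesicOn`): locally by definition, and on the whole
segment by uniqueness of geodesics. Hence the points of short `φ`-geodesics from `p` are related
to `p`.

*Moving along the Reeb flow.* Automorphisms commute with the flow `Ψ` of `ξ`, so the times `τ` for
which `p` is related to `Ψ_τ p` form a subgroup `T` of `ℝ` (`periods`). Following a `φ`-geodesic
from `p` and then the Reeb flow gives coordinates near `p` (`exists_adapted_coordinates`); let `f`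
be the coordinate that records the time spent on the Reeb flow. The values of `f` at related
points differ by elements of `T` (`sub_mem_periods`). If `T ≠ ℝ`, then `T` contains no interval,
so `f` is constant along short `φ`-geodesics starting at any nearby point, while `f` grows with
unit speed along `ξ`. It follows that `df = η` near `p` (`hasMFDerivAt_of_periods_ne_top`), hence
`dη = 0`, which contradicts `dη = g(·, φ ·)` and `φ² = Id - η ⊗ ξ` in dimension at least `3`
(`not_hasMFDerivAt_η`). So `T = ℝ`.

*Conclusion.* The adapted coordinates show that every point near `p` is related to `p`. The orbits
of `H` are therefore open, and as `M` is connected there is only one.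

The geodesics of small initial velocity, and the strict differentiability of the exponential map
and of the Reeb flow that makes the adapted coordinates a local homeomorphism, come from the
Picard–Lindelöf theorem in a chart (`exists_exponential`, `exists_flow_hasStrictFDerivAt`).
-/

namespace ParaSasaki

open scoped NNReal
open Set Metric

set_option maxSynthPendingDepth 3

/-! ### Flows of ordinary differential equations and the exponential map -/

section ODE

variable {E : Type*} [NormedAddCommGroup E] [NormedSpace ℝ E]

/-- The flow of a `C¹` vector field near a point: trajectories starting near `x₀` exist for a
uniform time, depend on the initial point in a Lipschitz way, and stay in a ball around `x₀` on
which the field is Lipschitz. -/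
theorem exists_local_flow [CompleteSpace E] {f : E → E} {x₀ : E} (hf : ContDiffAt ℝ 1 f x₀)
    {N : Set E} (hN : N ∈ 𝓝 x₀) :
    ∃ ε > (0 : ℝ), ∃ r > (0 : ℝ), ∃ (α : E → ℝ → E) (L K : ℝ≥0) (a : ℝ),
      0 < a ∧ LipschitzOnWith K f (closedBall x₀ a) ∧ closedBall x₀ a ⊆ N ∧
      (∀ x ∈ closedBall x₀ r, α x 0 = x ∧ ∀ t ∈ Icc (-ε) ε,
        HasDerivWithinAt (α x) (f (α x t)) (Icc (-ε) ε) t ∧ α x t ∈ closedBall x₀ a) ∧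
      ∀ t ∈ Icc (-ε) ε, LipschitzOnWith L (α · t) (closedBall x₀ r) := by
  obtain ⟨ε₀, hε₀, a₀, r₀, L₀, K, hr₀, hpl⟩ := IsPicardLindelof.of_contDiffAt_one hf
  have ha₀ : (0 : ℝ) < a₀ := by
    have h1 := (hpl 0).mul_max_le
    have h2 : (0 : ℝ) ≤ L₀ * max (0 + ε₀ - 0) (0 - (0 - ε₀)) := by
      have : (0 : ℝ) ≤ max (0 + ε₀ - 0) (0 - (0 - ε₀)) := le_max_of_le_left (by linarith)
      positivity
    have h3 : (0 : ℝ) < r₀ := hr₀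
    simp only at h1
    linarith
  -- shrink the Picard–Lindelöf data: the fixed points of the Picard iteration take values in the
  -- ball of radius `a`, which is chosen inside `N`
  obtain ⟨δ, hδ, hδN⟩ := Metric.nhds_basis_closedBall.mem_iff.1 hN
  let a : ℝ≥0 := min a₀ (.mk δ hδ.le)
  have ha : (0 : ℝ) < a := by
    rw [NNReal.coe_min]
    exact lt_min ha₀ hδ
  have haN : closedBall x₀ a ⊆ N :=
    (closedBall_subset_closedBall ((NNReal.coe_min _ _).trans_le (min_le_right _ _))).trans hδN
  have hr : a / 2 < a := NNReal.half_lt_self (by exact_mod_cast ha.ne')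
  obtain ⟨ε, hε, h⟩ := (hpl 0).exists_shrink_radius hε₀ (min_le_left _ _ : a ≤ a₀) hr
  -- a total choice of trajectories; outside the ball of radius `a / 2` its value is irrelevant
  have : ∀ x, ∃ β, ∀ hx : x ∈ closedBall x₀ (a / 2 : ℝ≥0),
      Function.IsFixedPt (ODE.FunSpace.next h hx) β := fun x => by
    by_cases hx : x ∈ closedBall x₀ (a / 2 : ℝ≥0)
    · obtain ⟨β, hβ⟩ := ODE.FunSpace.exists_isFixedPt_next h hx
      exact ⟨β, fun _ => hβ⟩
    · obtain ⟨β, hβ⟩ := ODE.FunSpace.exists_isFixedPt_next h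
        (mem_closedBall_self (a / 2 : ℝ≥0).2)
      exact ⟨β, fun h => absurd h hx⟩
  choose β hβ using this
  have h0 : (0 : ℝ) ∈ Icc (0 - ε) (0 + ε) := by simp [hε.le]
  have e1 : Icc (-ε) ε = Icc (0 - ε) (0 + ε) := by simp
  obtain ⟨L, hL⟩ := ODE.FunSpace.exists_forall_closedBall_funSpace_dist_le_mul h
  refine ⟨ε, hε, (a / 2 : ℝ≥0), by simpa using ha, fun x => (β x).compProj, L, K, a, ha,
    (h.lipschitzOnWith 0 h0), haN, fun x hx => ⟨?_, fun t ht => ⟨?_, ?_⟩⟩, fun t ht => ?_⟩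
  · have : (β x).compProj ((⟨0, h0⟩ : Icc (0 - ε) (0 + ε)) : ℝ) = x := by
      rw [ODE.FunSpace.compProj_val, ← hβ x hx, ODE.FunSpace.next_apply₀]
    exact this
  · rw [e1] at ht ⊢
    beta_reduce
    rw [ODE.FunSpace.compProj_apply]
    apply ODE.hasDerivWithinAt_picard_Icc (⟨0, h0⟩ : Icc (0 - ε) (0 + ε)).2 h.continuousOn_uncurry
      ((β x).continuous_compProj.continuousOn)
      (fun _ ht' ↦ (β x).compProj_mem_closedBall h.mul_max_le)
      x ht |>.congr_of_mem _ ht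
    intro t' ht'
    nth_rw 1 [← hβ x hx]
    rw [ODE.FunSpace.compProj_of_mem ht', ODE.FunSpace.next_apply]
  · exact (β x).compProj_mem_closedBall h.mul_max_le
  · rw [e1] at ht
    refine LipschitzOnWith.of_dist_le_mul fun x hx y hy ↦ ?_
    beta_reduce
    rw [ODE.FunSpace.compProj_apply, ODE.FunSpace.compProj_apply,
      ← ODE.FunSpace.toContinuousMap_apply_eq_apply, ← ODE.FunSpace.toContinuousMap_apply_eq_apply]
    have : Nonempty (Icc (0 - ε) (0 + ε)) := ⟨⟨0, h0⟩⟩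
    exact ContinuousMap.dist_le_iff_of_nonempty.mp
      (hL x y hx hy (β x) (β y) (hβ x hx) (hβ y hy)) _

/-- The flow of a `C¹` vector field is strictly differentiable, jointly in space and time, at
time `0`. -/
theorem exists_flow_hasStrictFDerivAt [CompleteSpace E] {f : E → E} {x₀ : E}
    (hf : ContDiffAt ℝ 1 f x₀) {N : Set E} (hN : N ∈ 𝓝 x₀) :
    ∃ ε > (0 : ℝ), ∃ r > (0 : ℝ), ∃ α : E → ℝ → E,
      (∀ x ∈ ball x₀ r, α x 0 = x ∧ ∀ t ∈ Ioo (-ε) ε,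
        HasDerivAt (α x) (f (α x t)) t ∧ α x t ∈ N) ∧
      HasStrictFDerivAt (fun q : E × ℝ => α q.1 q.2)
        (ContinuousLinearMap.fst ℝ E ℝ + (ContinuousLinearMap.snd ℝ E ℝ).smulRight (f x₀))
        (x₀, 0) := by
  obtain ⟨ε, hε, r, hr, α, L, K, a, ha, hK, haN, hα, hL⟩ := exists_local_flow hf hN
  refine ⟨ε, hε, r, hr, α, fun x hx => ⟨(hα x (ball_subset_closedBall hx)).1, fun t ht => ?_⟩, ?_⟩
  · obtain ⟨h1, h2⟩ := (hα x (ball_subset_closedBall hx)).2 t (Ioo_subset_Icc_self ht)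
    exact ⟨h1.hasDerivAt (Icc_mem_nhds ht.1 ht.2), haN h2⟩
  have h0 : (0 : ℝ) ∈ Icc (-ε) ε := ⟨by linarith, hε.le⟩
  have hx₀ : x₀ ∈ closedBall x₀ a := mem_closedBall_self ha.le
  -- the speed of the trajectories is bounded
  set B : ℝ := K * a + ‖f x₀‖ with hB
  have hB0 : 0 ≤ B := by positivity
  have hfB : ∀ x ∈ closedBall x₀ a, ‖f x‖ ≤ B := fun x hx => by
    have h1 := hK.norm_sub_le hx hx₀
    have h2 : ‖x - x₀‖ ≤ a := mem_closedBall_iff_norm.1 hx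
    have h3 := norm_le_norm_sub_add (f x) (f x₀)
    have h4 : (K : ℝ) * ‖x - x₀‖ ≤ K * a := by gcongr
    linarith
  have hmove : ∀ x ∈ closedBall x₀ r, ∀ t ∈ Icc (-ε) ε, ‖α x t - x‖ ≤ B * |t| := by
    intro x hx t ht
    have := Convex.norm_image_sub_le_of_norm_hasDerivWithin_le
      (fun τ hτ => ((hα x hx).2 τ hτ).1) (fun τ hτ => hfB _ ((hα x hx).2 τ hτ).2)
      (convex_Icc _ _) h0 ht
    rwa [(hα x hx).1, sub_zero, Real.norm_eq_abs] at this
  rw [hasStrictFDerivAt_iff_isLittleO, Asymptotics.isLittleO_iff]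
  intro c hc
  -- the radius that makes the two error terms below at most `c / 2`
  set η : ℝ := min (min ε r) (min (c / 2 / (K * L + 1)) (c / 2 / (K * (B + 1) + 1))) with hη
  have hη0 : 0 < η := by positivity
  have hev : ∀ᶠ p : (E × ℝ) × (E × ℝ) in 𝓝 ((x₀, (0 : ℝ)), (x₀, (0 : ℝ))),
      p ∈ ball ((x₀, (0 : ℝ)), (x₀, (0 : ℝ))) η := ball_mem_nhds _ hη0
  filter_upwards [hev]
  rintro ⟨⟨y, t⟩, y', s⟩ hp
  simp only [mem_ball, Prod.dist_eq, max_lt_iff, dist_zero_right, Real.norm_eq_abs] at hp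
  obtain ⟨⟨hy, ht⟩, hy', hs⟩ := hp
  have hηε : η ≤ ε := (min_le_left _ _).trans (min_le_left _ _)
  have hηr : η ≤ r := (min_le_left _ _).trans (min_le_right _ _)
  have hη1 : η * (K * L + 1) ≤ c / 2 := by
    rw [← le_div_iff₀ (by positivity)]
    exact (min_le_right _ _).trans (min_le_left _ _)
  have hη2 : η * (K * (B + 1) + 1) ≤ c / 2 := by
    rw [← le_div_iff₀ (by positivity)]
    exact (min_le_right _ _).trans (min_le_right _ _)
  have hyr : y ∈ closedBall x₀ r := mem_closedBall.2 (hy.le.trans hηr)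
  have hyr' : y' ∈ closedBall x₀ r := mem_closedBall.2 (hy'.le.trans hηr)
  have hsub : Icc (-η) η ⊆ Icc (-ε) ε := Icc_subset_Icc (neg_le_neg hηε) hηε
  have h0η : (0 : ℝ) ∈ Icc (-η) η := ⟨by linarith, hη0.le⟩
  have htη : t ∈ Icc (-η) η := abs_le.1 ht.le
  have hsη : s ∈ Icc (-η) η := abs_le.1 hs.le
  -- change of the initial point: `f` is `K`-Lipschitz and the flow is `L`-Lipschitz
  have e1 : ‖(α y t - α y' t) - (y - y')‖ ≤ (K * L * ‖y - y'‖) * |t| := by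
    have := Convex.norm_image_sub_le_of_norm_hasDerivWithin_le
      (f := fun τ => α y τ - α y' τ) (s := Icc (-η) η) (C := K * L * ‖y - y'‖)
      (fun τ hτ => (((hα y hyr).2 τ (hsub hτ)).1.mono hsub).sub
        (((hα y' hyr').2 τ (hsub hτ)).1.mono hsub))
      (fun τ hτ => by
        have h1 := hK.norm_sub_le ((hα y hyr).2 τ (hsub hτ)).2 ((hα y' hyr').2 τ (hsub hτ)).2
        have h2 := (hL τ (hsub hτ)).norm_sub_le hyr hyr'
        calc _ ≤ _ := h1
          _ ≤ K * (L * ‖y - y'‖) := by gcongr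
          _ = _ := by ring)
      (convex_Icc _ _) h0η htη
    simpa [(hα y hyr).1, (hα y' hyr').1] using this
  -- change of the time: along the trajectory of `y'` the field stays close to `f x₀`
  have e2 : ‖(α y' t - t • f x₀) - (α y' s - s • f x₀)‖ ≤ c / 2 * |t - s| := by
    refine Convex.norm_image_sub_le_of_norm_hasDerivWithin_le
      (f := fun τ => α y' τ - τ • f x₀) (s := Icc (-η) η) (C := c / 2)
      (fun τ hτ => (((hα y' hyr').2 τ (hsub hτ)).1.mono hsub).sub
        ((hasDerivAt_id τ).smul_const (f x₀)).hasDerivWithinAt)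
      (fun τ hτ => ?_) (convex_Icc _ _) hsη htη
    have h1 := hK.norm_sub_le ((hα y' hyr').2 τ (hsub hτ)).2 hx₀
    have h2 := hmove y' hyr' τ (hsub hτ)
    have h3 : ‖α y' τ - x₀‖ ≤ B * η + η := by
      have h4 : ‖y' - x₀‖ ≤ η := by rw [← dist_eq_norm]; exact hy'.le
      have h5 : B * |τ| ≤ B * η := by
        gcongr
        exact abs_le.2 hτ
      have := norm_sub_le_norm_sub_add_norm_sub (α y' τ) y' x₀
      linarith
    rw [one_smul]
    calc _ ≤ _ := h1
      _ ≤ K * (B * η + η) := by gcongr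
      _ ≤ η * (K * (B + 1) + 1) := by nlinarith
      _ ≤ c / 2 := hη2
  have e3 : K * L * ‖y - y'‖ * |t| ≤ c / 2 * ‖y - y'‖ := by
    have : K * L * |t| ≤ c / 2 := by
      have : (K * L : ℝ) * |t| ≤ K * L * η := by gcongr
      nlinarith
    calc _ = (K * L * |t|) * ‖y - y'‖ := by ring
      _ ≤ _ := by gcongr
  have n1 : ‖y - y'‖ ≤ ‖((y, t) : E × ℝ) - (y', s)‖ := norm_fst_le (((y, t) : E × ℝ) - (y', s))
  have n2 : |t - s| ≤ ‖((y, t) : E × ℝ) - (y', s)‖ := norm_snd_le (((y, t) : E × ℝ) - (y', s))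
  have e4 : α y t - α y' s - (ContinuousLinearMap.fst ℝ E ℝ
      + (ContinuousLinearMap.snd ℝ E ℝ).smulRight (f x₀)) ((y, t) - (y', s))
      = ((α y t - α y' t) - (y - y')) + ((α y' t - t • f x₀) - (α y' s - s • f x₀)) := by
    simp [sub_smul]
    abel
  simp only
  rw [e4]
  calc _ ≤ _ := norm_add_le _ _
    _ ≤ c / 2 * ‖y - y'‖ + c / 2 * |t - s| := add_le_add (e1.trans e3) e2
    _ ≤ c / 2 * ‖((y, t) : E × ℝ) - (y', s)‖ + c / 2 * ‖((y, t) : E × ℝ) - (y', s)‖ := by gcongr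
    _ = _ := by ring

/-- Local uniqueness for autonomous differential equations with `C¹` right-hand side. -/
theorem eventuallyEq_of_hasDerivAt {f : E → E} {c₁ c₂ : ℝ → E} {t₀ : ℝ}
    (hf : ContDiffAt ℝ 1 f (c₁ t₀)) (h₁ : ∀ᶠ t in 𝓝 t₀, HasDerivAt c₁ (f (c₁ t)) t)
    (h₂ : ∀ᶠ t in 𝓝 t₀, HasDerivAt c₂ (f (c₂ t)) t) (h : c₁ t₀ = c₂ t₀) :
    c₁ =ᶠ[𝓝 t₀] c₂ := by
  obtain ⟨K, s, hs, hK⟩ := hf.exists_lipschitzOnWith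
  have k₁ := h₁.self_of_nhds.continuousAt.preimage_mem_nhds hs
  have k₂ := h₂.self_of_nhds.continuousAt.preimage_mem_nhds (h ▸ hs)
  exact ODE_solution_unique_of_eventually (v := fun _ => f) (s := fun _ => s)
    (.of_forall fun _ => hK) (h₁.and k₁) (h₂.and k₂) h

/-- The first order system on `E × E` equivalent to the equation `y'' = A(y)(y', y')`. -/
noncomputable def secondOrderField (A : E → E →L[ℝ] E →L[ℝ] E) (z : E × E) : E × E :=
  (z.2, A z.1 z.2 z.2)

theorem contDiffAt_secondOrderField {A : E → E →L[ℝ] E →L[ℝ] E} {z : E × E}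
    (hA : ContDiffAt ℝ 1 A z.1) : ContDiffAt ℝ 1 (secondOrderField A) z := by
  have h1 : ContDiffAt ℝ 1 (fun z : E × E => A z.1) z := ContDiffAt.comp z hA contDiffAt_fst
  exact contDiffAt_snd.prodMk ((h1.clm_apply contDiffAt_snd).clm_apply contDiffAt_snd)

/-- The acceleration is quadratic in the velocity, so its strict derivative at velocity `0`
vanishes. -/
theorem hasStrictFDerivAt_quadratic_zero {A : E → E →L[ℝ] E →L[ℝ] E} {y₀ : E}
    (hA : ContDiffAt ℝ 1 A y₀) :
    HasStrictFDerivAt (fun z : E × E => A z.1 z.2 z.2) (0 : E × E →L[ℝ] E) (y₀, (0 : E)) := by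
  have h0 := hA.hasStrictFDerivAt one_ne_zero
  have h1 : HasStrictFDerivAt (fun z : E × E => A z.1)
      ((fderiv ℝ A y₀).comp (ContinuousLinearMap.fst ℝ E E)) (y₀, (0 : E)) :=
    HasStrictFDerivAt.comp (g := A) (f := Prod.fst) (y₀, (0 : E)) h0 hasStrictFDerivAt_fst
  have h2 := (h1.clm_apply hasStrictFDerivAt_snd).clm_apply hasStrictFDerivAt_snd
  refine h2.congr_fderiv ?_
  ext z <;> simp

/-- Solutions of `y'' = A(y)(y', y')` issuing from `y₀` with small initial velocity `v` live for a
uniform time, and their position at a fixed time `t₁` depends on `v` with strict derivative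
`t₁ • id` at `v = 0`. -/
theorem exists_exponential [CompleteSpace E] {A : E → E →L[ℝ] E →L[ℝ] E} {y₀ : E}
    (hA : ContDiffAt ℝ 1 A y₀) {N : Set (E × E)} (hN : N ∈ 𝓝 (y₀, (0 : E))) :
    ∃ a > (0 : ℝ), ∃ t₁ ∈ Ioo 0 a, ∃ r > (0 : ℝ), ∃ α : E → ℝ → E × E,
      (∀ v ∈ ball (0 : E) r, α v 0 = (y₀, v) ∧ ∀ t ∈ Ioo (-a) a,
        HasDerivAt (α v) (secondOrderField A (α v t)) t ∧ α v t ∈ N) ∧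
      HasStrictFDerivAt (fun v => (α v t₁).1) (t₁ • ContinuousLinearMap.id ℝ E) 0 ∧
      (α 0 t₁).1 = y₀ := by
  have hV : ContDiffAt ℝ 1 (secondOrderField A) (y₀, (0 : E)) := contDiffAt_secondOrderField hA
  obtain ⟨ε, hε, r, hr, α, L, K, a, ha, hK, haN, hα, hL⟩ := exists_local_flow hV hN
  have h0 : (0 : ℝ) ∈ Icc (-ε) ε := ⟨by linarith, hε.le⟩
  have h0' : (0 : ℝ) ∈ Ioo (-ε) ε := ⟨by linarith, hε⟩
  have hV0 : secondOrderField A (y₀, (0 : E)) = 0 := by simp [secondOrderField]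
  have hbase : ((y₀, (0 : E)) : E × E) ∈ closedBall (y₀, (0 : E)) r := mem_closedBall_self hr.le
  -- the trajectory of the equilibrium is constant
  have hconst : ∀ t ∈ Ioo (-ε) ε, α (y₀, 0) t = (y₀, 0) := by
    refine ODE_solution_unique_of_mem_Ioo (v := fun _ => secondOrderField A)
      (s := fun _ => closedBall (y₀, (0 : E)) a) (g := fun _ => (y₀, (0 : E)))
      (fun t _ => hK) h0' (fun t ht => ?_) (fun t ht => ⟨?_, mem_closedBall_self ha.le⟩)
      (hα _ hbase).1
    · obtain ⟨h1, h2⟩ := (hα _ hbase).2 t (Ioo_subset_Icc_self ht)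
      exact ⟨h1.hasDerivAt (Icc_mem_nhds ht.1 ht.2), h2⟩
    · rw [hV0]
      exact hasDerivAt_const _ _
  have hmem : ∀ v ∈ ball (0 : E) r, ((y₀, v) : E × E) ∈ closedBall (y₀, (0 : E)) r := by
    intro v hv
    simpa [Prod.dist_eq, hr.le] using (mem_ball_zero_iff.1 hv).le
  have ht₁ : ε / 2 ∈ Ioo (0 : ℝ) ε := ⟨by linarith, by linarith⟩
  refine ⟨ε, hε, ε / 2, ht₁, r, hr, fun v => α (y₀, v), fun v hv => ⟨(hα _ (hmem v hv)).1,
    fun t ht => ?_⟩, ?_, ?_⟩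
  · obtain ⟨h1, h2⟩ := (hα _ (hmem v hv)).2 t (Ioo_subset_Icc_self ht)
    exact ⟨h1.hasDerivAt (Icc_mem_nhds ht.1 ht.2), haN h2⟩
  · have hA' := hasStrictFDerivAt_quadratic_zero hA
    rw [hasStrictFDerivAt_iff_isLittleO, Asymptotics.isLittleO_iff] at hA' ⊢
    intro c hc
    -- the Lipschitz constant demanded of the acceleration; integrating twice up to time `ε / 2`
    -- turns it into at most `c`
    set c' : ℝ := c / (L * (ε / 2) * (ε / 2) + 1) with hc'
    have hc'0 : 0 < c' := by positivity
    have hcc : c' * (L * (ε / 2) * (ε / 2)) ≤ c := by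
      have : c' * (L * (ε / 2) * (ε / 2) + 1) = c := by
        rw [hc']
        field_simp
      linarith
    obtain ⟨δ, hδ, hδA⟩ := Metric.eventually_nhds_iff_ball.1 (hA' hc'0)
    have hη0 : 0 < min r (δ / (L + 1)) := by positivity
    filter_upwards [ball_mem_nhds ((0 : E), (0 : E)) hη0]
    rintro ⟨v, v'⟩ hp
    simp only [mem_ball, Prod.dist_eq, dist_zero_right, lt_min_iff, max_lt_iff] at hp
    obtain ⟨⟨hvr, hvr'⟩, hvδ, hvδ'⟩ := hp
    have hstay : ∀ w : E, ‖w‖ < r → ‖w‖ < δ / (L + 1) → ∀ t ∈ Icc (0 : ℝ) (ε / 2),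
        dist (α (y₀, w) t) (y₀, 0) < δ := by
      intro w hw hwδ t ht
      have ht' : t ∈ Ioo (-ε) ε := ⟨by linarith [ht.1], by linarith [ht.2]⟩
      have h1 := (hL t (Ioo_subset_Icc_self ht')).dist_le_mul _ (hmem w (by simpa using hw)) _ hbase
      rw [hconst t ht'] at h1
      have h2 : dist ((y₀, w) : E × E) (y₀, 0) = ‖w‖ := by simp [Prod.dist_eq]
      rw [h2] at h1
      rw [lt_div_iff₀ (by positivity)] at hwδ
      have : (0 : ℝ) ≤ ‖w‖ := norm_nonneg w
      nlinarith
    have hsub : Icc (0 : ℝ) (ε / 2) ⊆ Icc (-ε) ε := Icc_subset_Icc (by linarith) (by linarith)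
    have hv := hmem v (by simpa using hvr)
    have hv' := hmem v' (by simpa using hvr')
    have hd : ∀ w : E, ((y₀, w) : E × E) ∈ closedBall (y₀, (0 : E)) r → ∀ τ ∈ Icc (0 : ℝ) (ε / 2),
        HasDerivWithinAt (fun τ => (α (y₀, w) τ).1) (α (y₀, w) τ).2 (Icc 0 (ε / 2)) τ ∧
        HasDerivWithinAt (fun τ => (α (y₀, w) τ).2)
          (A (α (y₀, w) τ).1 (α (y₀, w) τ).2 (α (y₀, w) τ).2) (Icc 0 (ε / 2)) τ := by
      intro w hw τ hτ
      have h := (((hα _ hw).2 τ (hsub hτ)).1.mono hsub).hasFDerivWithinAt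
      exact ⟨by simpa [secondOrderField] using h.fst.hasDerivWithinAt,
        by simpa [secondOrderField] using h.snd.hasDerivWithinAt⟩
    have h00 : (0 : ℝ) ∈ Icc (0 : ℝ) (ε / 2) := ⟨le_rfl, by linarith⟩
    -- the difference of the velocities is nearly constant
    have key2 : ∀ t ∈ Icc (0 : ℝ) (ε / 2),
        ‖((α (y₀, v) t).2 - (α (y₀, v') t).2) - (v - v')‖ ≤ c' * (L * ‖v - v'‖) * (ε / 2) := by
      intro t ht
      have := Convex.norm_image_sub_le_of_norm_hasDerivWithin_le
        (f := fun τ => (α (y₀, v) τ).2 - (α (y₀, v') τ).2) (s := Icc 0 (ε / 2))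
        (C := c' * (L * ‖v - v'‖))
        (fun τ hτ => (hd v hv τ hτ).2.sub (hd v' hv' τ hτ).2)
        (fun τ hτ => by
          have h1 := hδA (α (y₀, v) τ, α (y₀, v') τ) (by
            simp only [mem_ball, Prod.dist_eq]
            refine max_lt ?_ ?_
            · simpa [Prod.dist_eq] using hstay v hvr hvδ τ hτ
            · simpa [Prod.dist_eq] using hstay v' hvr' hvδ' τ hτ)
          have h2 := (hL τ (hsub hτ)).norm_sub_le hv hv'
          simp only [_root_.zero_apply, sub_zero] at h1
          have h3 : ‖((y₀, v) : E × E) - (y₀, v')‖ = ‖v - v'‖ := by simp [Prod.norm_def]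
          rw [h3] at h2
          exact h1.trans (by gcongr))
        (convex_Icc _ _) h00 ht
      rw [(hα _ hv).1, (hα _ hv').1, sub_zero, Real.norm_eq_abs, abs_of_nonneg ht.1] at this
      exact this.trans (by gcongr; exact ht.2)
    -- hence the difference of the positions grows nearly linearly
    have key1 := Convex.norm_image_sub_le_of_norm_hasDerivWithin_le
      (f := fun τ => ((α (y₀, v) τ).1 - (α (y₀, v') τ).1) - τ • (v - v')) (s := Icc 0 (ε / 2))
      (C := c' * (L * ‖v - v'‖) * (ε / 2))
      (fun τ hτ => ((hd v hv τ hτ).1.sub (hd v' hv' τ hτ).1).sub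
        ((hasDerivAt_id τ).smul_const (v - v')).hasDerivWithinAt)
      (fun τ hτ => by
        have := key2 τ hτ
        rw [one_smul]
        exact this)
      (convex_Icc _ _) h00 (⟨by linarith, le_rfl⟩ : ε / 2 ∈ Icc (0 : ℝ) (ε / 2))
    rw [(hα _ hv).1, (hα _ hv').1, sub_zero, Real.norm_eq_abs, abs_of_nonneg ht₁.1.le] at key1
    simp only [sub_self, zero_smul, sub_zero] at key1
    simp only [_root_.smul_apply, ContinuousLinearMap.id_apply]
    calc _ ≤ _ := key1
      _ = (c' * (L * (ε / 2) * (ε / 2))) * ‖v - v'‖ := by ring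
      _ ≤ _ := by gcongr
  · simp only [hconst (ε / 2) ⟨by linarith, by linarith⟩]

end ODE

/-! ### Geodesics and Killing fields in coordinates -/

section Coordinates

variable {E : Type*} [NormedAddCommGroup E] [NormedSpace ℝ E]

section Bilinear

variable {X F G : Type*} [NormedAddCommGroup X] [NormedSpace ℝ X] [NormedAddCommGroup F]
  [NormedSpace ℝ F] [NormedAddCommGroup G] [NormedSpace ℝ G]

theorem hasFDerivAt_clm_apply₂ {B : X → E →L[ℝ] F →L[ℝ] G} {v : X → E} {w : X → F}
    {B' : X →L[ℝ] E →L[ℝ] F →L[ℝ] G} {v' : X →L[ℝ] E} {w' : X →L[ℝ] F} {y : X}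
    (hB : HasFDerivAt B B' y) (hv : HasFDerivAt v v' y) (hw : HasFDerivAt w w' y) :
    ∃ L : X →L[ℝ] G, HasFDerivAt (fun z => B z (v z) (w z)) L y ∧
      ∀ b, L b = B' b (v y) (w y) + B y (v' b) (w y) + B y (v y) (w' b) := by
  have h1 : HasFDerivAt (fun z => B z (v z)) _ y := HasFDerivAt.clm_apply (c := B) hB hv
  refine ⟨_, HasFDerivAt.clm_apply h1 hw, fun b => ?_⟩
  simp
  abel

theorem fderiv_clm_apply₂ {B : X → E →L[ℝ] F →L[ℝ] G} {v : X → E} {w : X → F} {y : X}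
    (hB : DifferentiableAt ℝ B y) (hv : DifferentiableAt ℝ v y) (hw : DifferentiableAt ℝ w y)
    (b : X) :
    fderiv ℝ (fun z => B z (v z) (w z)) y b = fderiv ℝ B y b (v y) (w y)
      + B y (fderiv ℝ v y b) (w y) + B y (v y) (fderiv ℝ w y b) := by
  obtain ⟨L, h1, h2⟩ := hasFDerivAt_clm_apply₂ hB.hasFDerivAt hv.hasFDerivAt hw.hasFDerivAt
  rw [h1.fderiv, h2]

theorem fderiv_clm_apply_apply {B : X → E →L[ℝ] G} {v : X → E} {y : X}
    (hB : DifferentiableAt ℝ B y) (hv : DifferentiableAt ℝ v y) (b : X) :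
    fderiv ℝ (fun z => B z (v z)) y b = fderiv ℝ B y b (v y) + B y (fderiv ℝ v y b) := by
  rw [(hB.hasFDerivAt.clm_apply hv.hasFDerivAt).fderiv]
  simp [add_comm]

theorem hasDerivAt_comp_curve {B : X → F} {c : ℝ → X} {c' : X} {t : ℝ}
    (hB : DifferentiableAt ℝ B (c t)) (hc : HasDerivAt c c' t) :
    HasDerivAt (fun s => B (c s)) (fderiv ℝ B (c t) c') t :=
  hB.hasFDerivAt.comp_hasDerivAt t hc

theorem hasFDerivAt_fderiv_comp {B : X → F} {θ : E → X} {θ' : E →L[ℝ] X} {y : E}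
    (hB : DifferentiableAt ℝ B (θ y)) (hθ : HasFDerivAt θ θ' y) :
    HasFDerivAt (fun z => B (θ z)) ((fderiv ℝ B (θ y)).comp θ') y :=
  hB.hasFDerivAt.comp y hθ

end Bilinear

/-- The left-hand side of the geodesic equation, with lowered index, for the metric `g` on an open
part of a normed space: for a curve `c` through `x` with velocity `u` and acceleration `a` it is
`g(a, w) + ∂_u g(u, w) - ½ ∂_w g(u, u)`. -/
noncomputable def geodesicResidual (g : E → E →L[ℝ] E →L[ℝ] ℝ) (x u a w : E) : ℝ :=
  g x a w + fderiv ℝ g x u u w - (1 / 2) * fderiv ℝ g x w u u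

/-- The geodesic equation is natural under local isometries `θ`: if `g' = θ^* g`, the second
derivative of `θ`, which appears both in the derivatives of `g'` and in the acceleration of the
image curve, cancels because it is symmetric. -/
theorem geodesicResidual_pullback {g g' : E → E →L[ℝ] E →L[ℝ] ℝ} {θ : E → E} {y : E}
    (hθ : ContDiffAt ℝ 2 θ y) (hg : DifferentiableAt ℝ g (θ y))
    (hg' : ∀ᶠ z in 𝓝 y, ∀ v w, g' z v w = g (θ z) (fderiv ℝ θ z v) (fderiv ℝ θ z w))
    (hg'd : DifferentiableAt ℝ g' y) (hsymm : ∀ v w, g (θ y) v w = g (θ y) w v) (u a w : E) :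
    geodesicResidual g' y u a w = geodesicResidual g (θ y) (fderiv ℝ θ y u)
      (fderiv ℝ (fderiv ℝ θ) y u u + fderiv ℝ θ y a) (fderiv ℝ θ y w) := by
  have hθ1 : HasFDerivAt θ (fderiv ℝ θ y) y := (hθ.differentiableAt (by simp)).hasFDerivAt
  have hθ2 : HasFDerivAt (fderiv ℝ θ) (fderiv ℝ (fderiv ℝ θ) y) y :=
    ((hθ.fderiv_right (m := 1) le_rfl).differentiableAt (by simp)).hasFDerivAt
  have hD : ∀ v w b, fderiv ℝ g' y b v w
      = fderiv ℝ g (θ y) (fderiv ℝ θ y b) (fderiv ℝ θ y v) (fderiv ℝ θ y w)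
        + g (θ y) (fderiv ℝ (fderiv ℝ θ) y b v) (fderiv ℝ θ y w)
        + g (θ y) (fderiv ℝ θ y v) (fderiv ℝ (fderiv ℝ θ) y b w) := by
    intro v w b
    have h1 : HasFDerivAt (fun z => g (θ z)) ((fderiv ℝ g (θ y)).comp (fderiv ℝ θ y)) y :=
      hasFDerivAt_fderiv_comp (F := E →L[ℝ] E →L[ℝ] ℝ) (B := g) hg hθ1
    have h2 := fderiv_clm_apply₂ h1.differentiableAt
      (hθ2.differentiableAt.clm_apply (differentiableAt_const v))
      (hθ2.differentiableAt.clm_apply (differentiableAt_const w)) b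
    have h3 := fderiv_clm_apply₂ hg'd (differentiableAt_const v) (differentiableAt_const w) b
    have h4 : (fun z => g' z v w)
        =ᶠ[𝓝 y] fun z => g (θ z) (fderiv ℝ θ z v) (fderiv ℝ θ z w) := by
      filter_upwards [hg'] with z hz using hz v w
    rw [h4.fderiv_eq, h2, h1.fderiv,
      fderiv_clm_apply_apply hθ2.differentiableAt (differentiableAt_const v),
      fderiv_clm_apply_apply hθ2.differentiableAt (differentiableAt_const w)] at h3
    simpa using h3.symm
  have hs : fderiv ℝ (fderiv ℝ θ) y w u = fderiv ℝ (fderiv ℝ θ) y u w :=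
    (hθ.isSymmSndFDerivAt (by simp)) w u
  simp only [geodesicResidual, hD, hg'.self_of_nhds, map_add, _root_.add_apply, hs]
  rw [hsymm (fderiv ℝ (fderiv ℝ θ) y u w)]
  ring

theorem hasDerivAt_deriv_of_contDiffAt {c : ℝ → E} {t : ℝ} (hc : ContDiffAt ℝ 2 c t) :
    HasDerivAt c (deriv c t) t ∧ HasDerivAt (deriv c) (deriv (deriv c) t) t := by
  refine ⟨(hc.differentiableAt (by simp)).hasDerivAt, ?_⟩
  have h1 : DifferentiableAt ℝ (fderiv ℝ c) t :=
    (hc.fderiv_right (m := 1) le_rfl).differentiableAt (by simp)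
  exact (h1.clm_apply (differentiableAt_const (1 : ℝ))).hasDerivAt

theorem deriv_deriv_comp {θ : E → E} {c : ℝ → E} {t : ℝ} (hθ : ContDiffAt ℝ 2 θ (c t))
    (hc : ContDiffAt ℝ 2 c t) :
    deriv (fun s => θ (c s)) t = fderiv ℝ θ (c t) (deriv c t) ∧
    deriv (deriv fun s => θ (c s)) t
      = fderiv ℝ (fderiv ℝ θ) (c t) (deriv c t) (deriv c t)
        + fderiv ℝ θ (c t) (deriv (deriv c) t) := by
  have hev : ∀ᶠ s in 𝓝 t, deriv (fun s => θ (c s)) s = fderiv ℝ θ (c s) (deriv c s) := by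
    have h1 := hc.continuousAt.eventually (hθ.eventually (by simp))
    filter_upwards [h1, hc.eventually (by simp)] with s hs hs'
    exact ((hs.differentiableAt (by simp)).hasFDerivAt.comp_hasDerivAt s
      (hs'.differentiableAt (by simp)).hasDerivAt).deriv
  refine ⟨hev.self_of_nhds, ?_⟩
  rw [Filter.EventuallyEq.deriv_eq (f₁ := deriv fun s => θ (c s)) hev]
  have hθ2 : HasFDerivAt (fderiv ℝ θ) (fderiv ℝ (fderiv ℝ θ) (c t)) (c t) :=
    ((hθ.fderiv_right (m := 1) le_rfl).differentiableAt (by simp)).hasFDerivAt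
  obtain ⟨hc1, hc2⟩ := hasDerivAt_deriv_of_contDiffAt hc
  exact ((hθ2.comp_hasDerivAt t hc1).clm_apply hc2).deriv

/-- The structure equations of a para-Sasakian structure, in coordinates, imply that the Reeb field
is Killing. The vanishing of `N(·, ξ)`, which is `hN`, gives `L_ξ φ = 0`, and `ι_ξ dη = 0` gives
`L_ξ dη = 0`; as `dη = g(·, φ ·)`, the form `L_ξ g` vanishes on all pairs `(u, φ v)`. On `(u, ξ)` it
is `L_ξ η`, which vanishes as well. -/
theorem killing_of_paraSasakian {η : E → E →L[ℝ] ℝ} {ξ : E → E} {φ : E → E →L[ℝ] E}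
    {g : E → E →L[ℝ] E →L[ℝ] ℝ} {y : E}
    (hη : ContDiffAt ℝ 2 η y) (hξ : DifferentiableAt ℝ ξ y) (hφ : DifferentiableAt ℝ φ y)
    (hg : DifferentiableAt ℝ g y)
    (hdη : ∀ᶠ z in 𝓝 y, ∀ u v, fderiv ℝ η z u v - fderiv ℝ η z v u = 2 * g z u (φ z v))
    (hηξ : ∀ᶠ z in 𝓝 y, η z (ξ z) = 1)
    (hφφ : ∀ᶠ z in 𝓝 y, ∀ v, φ z (φ z v) = v - η z v • ξ z)
    (hgφ : ∀ᶠ z in 𝓝 y, ∀ v w, g z (φ z v) (φ z w) = - g z v w + η z v * η z w)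
    (hN : ∀ u, φ y (φ y (fderiv ℝ ξ y u) - fderiv ℝ ξ y (φ y u) + fderiv ℝ φ y (ξ y) u) = 0)
    (u w : E) :
    fderiv ℝ g y (ξ y) u w + g y (fderiv ℝ ξ y u) w + g y u (fderiv ℝ ξ y w) = 0 := by
  have hηd : DifferentiableAt ℝ η y := hη.differentiableAt (by simp)
  have hη2 : DifferentiableAt ℝ (fderiv ℝ η) y :=
    (hη.fderiv_right (m := 1) le_rfl).differentiableAt (by simp)
  -- pointwise algebra: `φ ξ = 0`, `η ∘ φ = 0` and `g(ξ, ·) = η`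
  have hφξ : ∀ᶠ z in 𝓝 y, φ z (ξ z) = 0 := by
    filter_upwards [hηξ, hφφ] with z h1 h2
    have h3 : φ z (φ z (ξ z)) = 0 := by rw [h2, h1, one_smul, sub_self]
    have h4 := h2 (φ z (ξ z))
    rw [h3, map_zero] at h4
    have h5 : φ z (ξ z) = η z (φ z (ξ z)) • ξ z := (sub_eq_zero.1 h4.symm)
    have h6 : η z (φ z (ξ z)) = 0 := by
      have h7 : φ z (φ z (ξ z)) = η z (φ z (ξ z)) • φ z (ξ z) := by
        conv_lhs => rw [h5, map_smul]
      rw [h3, h5, map_smul, h1, smul_smul] at h7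
      have h8 := congrArg (η z) h7
      rw [map_zero, map_smul, h1] at h8
      simpa using h8.symm
    rw [h5, h6, zero_smul]
  have hηφ : ∀ᶠ z in 𝓝 y, ∀ v, η z (φ z v) = 0 := by
    filter_upwards [hηξ, hφφ, hφξ] with z h1 h2 h3 v
    have h4 := h2 (φ z v)
    rw [h2 v, map_sub, map_smul, h3, smul_zero, sub_zero] at h4
    have h5 := congrArg (η z) h4
    rw [map_sub, map_smul, h1] at h5
    simpa using h5
  have hgξ : ∀ᶠ z in 𝓝 y, ∀ v, g z v (ξ z) = η z v := by
    filter_upwards [hηξ, hφξ, hgφ] with z h1 h3 h4 v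
    have := h4 v (ξ z)
    rw [h3, map_zero, h1] at this
    linarith
  -- differentiated identities
  have d1 : ∀ b, fderiv ℝ η y b (ξ y) + η y (fderiv ℝ ξ y b) = 0 := by
    intro b
    rw [← fderiv_clm_apply_apply hηd hξ,
      Filter.EventuallyEq.fderiv_eq (f := fun _ => (1 : ℝ)) hηξ]
    simp
  have d2 : ∀ b v, fderiv ℝ η y b (φ y v) + η y (fderiv ℝ φ y b v) = 0 := by
    intro b v
    have h1 := fderiv_clm_apply_apply hηd (hφ.clm_apply (differentiableAt_const v)) b
    have h2 : (fun z => η z (φ z v)) =ᶠ[𝓝 y] fun _ => (0 : ℝ) := by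
      filter_upwards [hηφ] with z hz using hz v
    rw [h2.fderiv_eq, fderiv_clm_apply_apply hφ (differentiableAt_const v)] at h1
    simpa using h1.symm
  have d3 : ∀ b v, fderiv ℝ g y b v (ξ y) + g y v (fderiv ℝ ξ y b) = fderiv ℝ η y b v := by
    intro b v
    have h1 := fderiv_clm_apply₂ hg (differentiableAt_const v) hξ b
    have h2 : (fun z => g z v (ξ z)) =ᶠ[𝓝 y] fun z => η z v := by
      filter_upwards [hgξ] with z hz using hz v
    rw [h2.fderiv_eq, fderiv_clm_apply_apply hηd (differentiableAt_const v)] at h1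
    simpa using h1.symm
  -- `ξ` is in the kernel of `dη`
  have hι : ∀ᶠ z in 𝓝 y, ∀ v, fderiv ℝ η z (ξ z) v = fderiv ℝ η z v (ξ z) := by
    filter_upwards [hdη, hφξ] with z h1 h2 v
    have := h1 v (ξ z)
    rw [h2, map_zero] at this
    linarith
  -- the derivative of `ι_ξ dη = 0` in the direction `b`
  have d4 : ∀ b v, fderiv ℝ (fderiv ℝ η) y b (ξ y) v + fderiv ℝ η y (fderiv ℝ ξ y b) v
      = fderiv ℝ (fderiv ℝ η) y b v (ξ y) + fderiv ℝ η y v (fderiv ℝ ξ y b) := by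
    intro b v
    have h1 := fderiv_clm_apply₂ hη2 hξ (differentiableAt_const v) b
    have h2 := fderiv_clm_apply₂ hη2 (differentiableAt_const v) hξ b
    have h3 : (fun z => fderiv ℝ η z (ξ z) v) =ᶠ[𝓝 y] fun z => fderiv ℝ η z v (ξ z) := by
      filter_upwards [hι] with z hz using hz v
    rw [h3.fderiv_eq, h2] at h1
    simpa using h1.symm
  -- the derivative of `dη(u, v) = g(u, φ v)` in the direction `b`
  have d5 : ∀ b u v, fderiv ℝ (fderiv ℝ η) y b u v - fderiv ℝ (fderiv ℝ η) y b v u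
      = 2 * (fderiv ℝ g y b u (φ y v) + g y u (fderiv ℝ φ y b v)) := by
    intro b u v
    have h1 := fderiv_clm_apply₂ hη2 (differentiableAt_const u) (differentiableAt_const v) b
    have h2 := fderiv_clm_apply₂ hη2 (differentiableAt_const v) (differentiableAt_const u) b
    have h3 := fderiv_clm_apply₂ hg (differentiableAt_const u)
      (hφ.clm_apply (differentiableAt_const v)) b
    rw [fderiv_clm_apply_apply hφ (differentiableAt_const v)] at h3
    have h4 : (fun z => fderiv ℝ η z u v - fderiv ℝ η z v u)
        =ᶠ[𝓝 y] fun z => (2 : ℝ) * g z u (φ z v) := by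
      filter_upwards [hdη] with z hz using hz u v
    have h5 := h4.fderiv_eq (𝕜 := ℝ)
    have k1 : ∀ u v, DifferentiableAt ℝ (fun z => fderiv ℝ η z u v) y := fun u v =>
      (hη2.clm_apply (differentiableAt_const u)).clm_apply (differentiableAt_const v)
    have k2 : DifferentiableAt ℝ (fun z => g z u (φ z v)) y :=
      (hg.clm_apply (differentiableAt_const u)).clm_apply
        (hφ.clm_apply (differentiableAt_const v))
    rw [fderiv_fun_sub (k1 u v) (k1 v u), fderiv_const_mul k2] at h5
    have h6 := congrArg (fun L => L b) h5
    simp only [_root_.sub_apply, _root_.smul_apply, h1, h2, h3] at h6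
    simpa using h6
  have hsym : ∀ b u, fderiv ℝ (fderiv ℝ η) y b u = fderiv ℝ (fderiv ℝ η) y u b := fun b u =>
    (hη.isSymmSndFDerivAt (by simp)) b u
  -- the Lie derivative of `φ` along `ξ` vanishes
  have hLφ : ∀ v, φ y (fderiv ℝ ξ y v) + fderiv ℝ φ y (ξ y) v = fderiv ℝ ξ y (φ y v) := by
    intro v
    set k := φ y (fderiv ℝ ξ y v) - fderiv ℝ ξ y (φ y v) + fderiv ℝ φ y (ξ y) v with hk
    have h1 : k = η y k • ξ y := by
      have := hφφ.self_of_nhds k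
      rw [hN v, map_zero] at this
      exact (sub_eq_zero.1 this.symm)
    have h2 : η y k = 0 := by
      have e1 := d1 (φ y v)
      have e2 := d2 (ξ y) v
      have e3 := hι.self_of_nhds (φ y v)
      rw [hk, map_add, map_sub, hηφ.self_of_nhds]
      linarith
    rw [h2, zero_smul, hk] at h1
    rw [← sub_eq_zero, ← h1]
    abel
  -- the Lie derivative of `g` vanishes on `(u, φ v)` since that of `dη` does
  have hLφv : ∀ u v, fderiv ℝ g y (ξ y) u (φ y v) + g y (fderiv ℝ ξ y u) (φ y v)
      + g y u (fderiv ℝ ξ y (φ y v)) = 0 := by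
    intro u v
    have e1 := d5 (ξ y) u v
    have e2 := d4 u v
    have e3 := d4 v u
    have e4 := hdη.self_of_nhds (fderiv ℝ ξ y u) v
    have e5 := hdη.self_of_nhds u (fderiv ℝ ξ y v)
    rw [hsym (ξ y) u, hsym (ξ y) v] at e1
    rw [hsym v u] at e3
    rw [← hLφ v, map_add]
    linarith
  have hLξ : fderiv ℝ g y (ξ y) u (ξ y) + g y (fderiv ℝ ξ y u) (ξ y)
      + g y u (fderiv ℝ ξ y (ξ y)) = 0 := by
    have e1 := d3 (ξ y) u
    have e2 := hgξ.self_of_nhds (fderiv ℝ ξ y u)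
    have e3 := d1 u
    have e4 := hι.self_of_nhds u
    linarith
  have hw : w = φ y (φ y w) + η y w • ξ y := by
    rw [hφφ.self_of_nhds]
    abel
  rw [hw]
  simp only [map_add, map_smul, smul_eq_mul]
  linear_combination hLφv u (φ y w) + η y w * hLξ

/-- A Killing field has constant product with the velocity of a geodesic. -/
theorem hasDerivAt_inner_killing {g : E → E →L[ℝ] E →L[ℝ] ℝ} {ξ : E → E} {c : ℝ → E} {t : ℝ}
    (hg : DifferentiableAt ℝ g (c t)) (hξ : DifferentiableAt ℝ ξ (c t))
    (hc : HasDerivAt c (deriv c t) t) (hc' : HasDerivAt (deriv c) (deriv (deriv c) t) t)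
    (hsymm : ∀ v w, g (c t) v w = g (c t) w v)
    (hgeo : geodesicResidual g (c t) (deriv c t) (deriv (deriv c) t) (ξ (c t)) = 0)
    (hK : ∀ u w, fderiv ℝ g (c t) (ξ (c t)) u w + g (c t) (fderiv ℝ ξ (c t) u) w
      + g (c t) u (fderiv ℝ ξ (c t) w) = 0) :
    HasDerivAt (fun s => g (c s) (deriv c s) (ξ (c s))) 0 t := by
  have h1 : HasDerivAt (fun s => g (c s)) (fderiv ℝ g (c t) (deriv c t)) t :=
    hasDerivAt_comp_curve (F := E →L[ℝ] E →L[ℝ] ℝ) (B := g) hg hc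
  have h2 : HasDerivAt (fun s => ξ (c s)) (fderiv ℝ ξ (c t) (deriv c t)) t :=
    hasDerivAt_comp_curve hξ hc
  obtain ⟨L, h3, hL⟩ := hasFDerivAt_clm_apply₂ h1.hasFDerivAt hc'.hasFDerivAt h2.hasFDerivAt
  have h5 := h3.hasDerivAt
  refine h5.congr_deriv ?_
  have h4 := hK (deriv c t) (deriv c t)
  rw [hsymm (fderiv ℝ ξ (c t) (deriv c t))] at h4
  simp only [geodesicResidual] at hgeo
  rw [hL]
  simp only [ContinuousLinearMap.toSpanSingleton_apply_one]
  linarith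

end Coordinates

/-! ### The geodesic equation in normal form -/

section Acceleration

variable {E : Type*} [NormedAddCommGroup E] [NormedSpace ℝ E]

/-- The map that takes the derivative `T = dg` of a metric to the trilinear form
`(u, v, w) ↦ ½ ∂_w g(u, v) - ∂_u g(v, w)`, whose diagonal in `u, v` is the right-hand side of the
geodesic equation with lowered index. -/
noncomputable def geodesicForce :
    (E →L[ℝ] E →L[ℝ] E →L[ℝ] ℝ) →L[ℝ] (E →L[ℝ] E →L[ℝ] E →L[ℝ] ℝ) :=
  (1 / 2 : ℝ) • ((ContinuousLinearMap.compL ℝ E (E →L[ℝ] E →L[ℝ] ℝ) (E →L[ℝ] E →L[ℝ] ℝ)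
      (ContinuousLinearMap.flipₗᵢ ℝ E E ℝ).toContinuousLinearEquiv.toContinuousLinearMap) ∘L
    (ContinuousLinearMap.flipₗᵢ ℝ E E (E →L[ℝ] ℝ)).toContinuousLinearEquiv.toContinuousLinearMap)
  - ContinuousLinearMap.id ℝ _

theorem geodesicForce_apply (T : E →L[ℝ] E →L[ℝ] E →L[ℝ] ℝ) (u v w : E) :
    geodesicForce T u v w = (1 / 2) * T w u v - T u v w := by
  simp [geodesicForce]

/-- The acceleration of geodesics, as a bilinear form in the velocity: the form `geodesicForce`
with its index raised by `g`. Where `g` is degenerate the inverse is zero and the value has no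
meaning. -/
noncomputable def geodesicAcceleration (g : E → E →L[ℝ] E →L[ℝ] ℝ) (y : E) :
    E →L[ℝ] E →L[ℝ] E :=
  (ContinuousLinearMap.compL ℝ E (E →L[ℝ] ℝ) E (g y).inverse) ∘L (geodesicForce (fderiv ℝ g y))

variable [FiniteDimensional ℝ E]

theorem isInvertible_of_nondegenerate {B : E →L[ℝ] E →L[ℝ] ℝ}
    (hB : ∀ v, (∀ w, B v w = 0) → v = 0) : B.IsInvertible := by
  have hinj : Function.Injective (B : E →ₗ[ℝ] E →L[ℝ] ℝ) := by
    rw [injective_iff_map_eq_zero]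
    intro v hv
    exact hB v fun w => congrArg (fun L => L w) hv
  have hdim : Module.finrank ℝ E = Module.finrank ℝ (E →L[ℝ] ℝ) := by
    rw [← (LinearMap.toContinuousLinearMap (𝕜 := ℝ) (E := E) (F' := ℝ)).finrank_eq]
    exact (Subspace.dual_finrank_eq (K := ℝ) (V := E)).symm
  refine ⟨(LinearEquiv.ofInjectiveOfFinrankEq (B : E →ₗ[ℝ] E →L[ℝ] ℝ) hinj
    hdim).toContinuousLinearEquiv, ?_⟩
  ext v w
  rfl

theorem contDiffAt_geodesicAcceleration {g : E → E →L[ℝ] E →L[ℝ] ℝ} {y : E}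
    (hg : ContDiffAt ℝ 2 g y) (hB : ∀ v, (∀ w, g y v w = 0) → v = 0) :
    ContDiffAt ℝ 1 (geodesicAcceleration g) y := by
  have h1 : ContDiffAt ℝ 1 (fderiv ℝ g) y := hg.fderiv_right le_rfl
  have h2 : ContDiffAt ℝ 1 (fun z => geodesicForce (fderiv ℝ g z)) y :=
    (ContinuousLinearMap.contDiff geodesicForce).contDiffAt.comp y h1
  have h3 : ContDiffAt ℝ 1 (fun z => (g z).inverse) y := by
    obtain ⟨e, he⟩ := isInvertible_of_nondegenerate hB
    have h4 : ContDiffAt ℝ 1 ContinuousLinearMap.inverse (g y) := he ▸ contDiffAt_map_inverse e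
    exact h4.comp y (hg.of_le (by norm_num))
  exact ((ContinuousLinearMap.contDiff _).contDiffAt.comp y h3).clm_comp h2

theorem geodesicResidual_eq_zero_iff {g : E → E →L[ℝ] E →L[ℝ] ℝ} {y : E}
    (hB : ∀ v, (∀ w, g y v w = 0) → v = 0) (u a : E) :
    (∀ w, geodesicResidual g y u a w = 0) ↔ a = geodesicAcceleration g y u u := by
  have hinv := isInvertible_of_nondegenerate hB
  have h1 : ∀ w, g y (geodesicAcceleration g y u u) w
      = (1 / 2) * fderiv ℝ g y w u u - fderiv ℝ g y u u w := by
    intro w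
    rw [← geodesicForce_apply]
    exact congrArg (fun L => L w)
      (hinv.self_apply_inverse (geodesicForce (fderiv ℝ g y) u u))
  constructor
  · intro h
    rw [← sub_eq_zero]
    refine hB _ fun w => ?_
    have := h w
    simp only [geodesicResidual] at this
    rw [map_sub, _root_.sub_apply, h1]
    linarith
  · rintro rfl w
    simp only [geodesicResidual, h1]
    ring

end Acceleration

/-! ### Coordinate frames -/

section Chart

theorem two_le_infty : (2 : WithTop ℕ∞) ≤ ∞ := WithTop.coe_le_coe.2 (le_top : (2 : ℕ∞) ≤ ⊤)

variable {d : ℕ} {M : Type*} [TopologicalSpace M] [ChartedSpace (EuclideanSpace ℝ (Fin d)) M]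
  [IsManifold (𝓡 d) ∞ M]

/-- The coordinate frame of the chart at `p`: the derivative of the inverse chart at `y`. It is
meaningful for `y` in the target of the chart. -/
noncomputable def chartFrame (p : M) (y : EuclideanSpace ℝ (Fin d)) :
    EuclideanSpace ℝ (Fin d) →L[ℝ] TangentSpace (𝓡 d) ((extChartAt (𝓡 d) p).symm y) :=
  mfderiv 𝓘(ℝ, EuclideanSpace ℝ (Fin d)) (𝓡 d) (extChartAt (𝓡 d) p).symm y

/-- The coordinate coframe of the chart at `p`: the inverse of the coordinate frame. -/
noncomputable def chartCoframe (p : M) (y : EuclideanSpace ℝ (Fin d)) :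
    TangentSpace (𝓡 d) ((extChartAt (𝓡 d) p).symm y) →L[ℝ] EuclideanSpace ℝ (Fin d) :=
  (chartFrame p y).inverse

omit [IsManifold (𝓡 d) ∞ M] in
theorem mem_target_of_mem_source {p x : M}
    (hx : x ∈ (chartAt (EuclideanSpace ℝ (Fin d)) p).source) :
    extChartAt (𝓡 d) p x ∈ (extChartAt (𝓡 d) p).target :=
  (extChartAt (𝓡 d) p).map_source (by rwa [extChartAt_source])

theorem contMDiffAt_chart_symm {p : M} {y : EuclideanSpace ℝ (Fin d)}
    (hy : y ∈ (extChartAt (𝓡 d) p).target) :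
    ContMDiffAt 𝓘(ℝ, EuclideanSpace ℝ (Fin d)) (𝓡 d) ∞ (extChartAt (𝓡 d) p).symm y :=
  (contMDiffOn_extChartAt_symm p).contMDiffAt ((isOpen_extChartAt_target (I := 𝓡 d) p).mem_nhds hy)

theorem isInvertible_chartFrame {p : M} {y : EuclideanSpace ℝ (Fin d)}
    (hy : y ∈ (extChartAt (𝓡 d) p).target) : (chartFrame p y).IsInvertible := by
  have := isInvertible_mfderivWithin_extChartAt_symm (I := 𝓡 d) hy
  rwa [modelWithCornersSelf_coe, range_id, mfderivWithin_univ] at this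

theorem chartFrame_chartCoframe {p : M} {y : EuclideanSpace ℝ (Fin d)}
    (hy : y ∈ (extChartAt (𝓡 d) p).target)
    (v : TangentSpace (𝓡 d) ((extChartAt (𝓡 d) p).symm y)) :
    chartFrame p y (chartCoframe p y v) = v :=
  (isInvertible_chartFrame hy).self_apply_inverse v

theorem chartCoframe_chartFrame {p : M} {y : EuclideanSpace ℝ (Fin d)}
    (hy : y ∈ (extChartAt (𝓡 d) p).target) (v : EuclideanSpace ℝ (Fin d)) :
    chartCoframe p y (chartFrame p y v) = v :=
  (isInvertible_chartFrame hy).inverse_apply_self v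

theorem contMDiffOn_chartFrame (p : M) (v : EuclideanSpace ℝ (Fin d)) :
    ContMDiffOn 𝓘(ℝ, EuclideanSpace ℝ (Fin d)) (𝓡 d).tangent ∞
      (fun y => (⟨(extChartAt (𝓡 d) p).symm y, chartFrame p y v⟩ : TangentBundle (𝓡 d) M))
      (extChartAt (𝓡 d) p).target := by
  have h1 := (contMDiffOn_extChartAt_symm (I := 𝓡 d) (n := ∞) p).contMDiffOn_tangentMapWithin
    (m := ∞) le_rfl (isOpen_extChartAt_target (I := 𝓡 d) p).uniqueMDiffOn
  have h2 : ContMDiff 𝓘(ℝ, EuclideanSpace ℝ (Fin d)) 𝓘(ℝ, EuclideanSpace ℝ (Fin d)).tangent ∞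
      (fun y => (⟨y, v⟩ : TangentBundle 𝓘(ℝ, EuclideanSpace ℝ (Fin d)) _)) :=
    contMDiff_vectorSpace_iff_contDiff.2 contDiff_const
  refine (h1.comp h2.contMDiffOn (fun y hy => hy)).congr fun y hy => ?_
  simp only [Function.comp, tangentMapWithin]
  rw [mfderivWithin_of_isOpen (isOpen_extChartAt_target (I := 𝓡 d) p) hy]
  rfl

theorem contMDiffAt_chartFrame {p : M} {y : EuclideanSpace ℝ (Fin d)}
    (hy : y ∈ (extChartAt (𝓡 d) p).target) (v : EuclideanSpace ℝ (Fin d)) :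
    ContMDiffAt 𝓘(ℝ, EuclideanSpace ℝ (Fin d)) (𝓡 d).tangent ∞
      (fun y => (⟨(extChartAt (𝓡 d) p).symm y, chartFrame p y v⟩ : TangentBundle (𝓡 d) M)) y :=
  (contMDiffOn_chartFrame p v).contMDiffAt ((isOpen_extChartAt_target (I := 𝓡 d) p).mem_nhds hy)

end Chart

namespace SemiRiemannianMetric

variable {d : ℕ} {M : Type*} [TopologicalSpace M] [ChartedSpace (EuclideanSpace ℝ (Fin d)) M]
  [IsManifold (𝓡 d) ∞ M] (g : SemiRiemannianMetric d M)

/-- The metric in the chart at `p`, as a function with values in bilinear forms. -/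
noncomputable def inChartForm (p : M) (y : EuclideanSpace ℝ (Fin d)) :
    EuclideanSpace ℝ (Fin d) →L[ℝ] EuclideanSpace ℝ (Fin d) →L[ℝ] ℝ :=
  (ContinuousLinearMap.precomp ℝ (chartFrame p y)) ∘L (g.val _) ∘L (chartFrame p y)

theorem inChartForm_apply (p : M) (y v w : EuclideanSpace ℝ (Fin d)) :
    g.inChartForm p y v w
      = g.val ((extChartAt (𝓡 d) p).symm y) (chartFrame p y v) (chartFrame p y w) := rfl

theorem inChart_eq (p : M) (y v w : EuclideanSpace ℝ (Fin d)) :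
    g.inChart p y v w = g.inChartForm p y v w := rfl

theorem inChartForm_symm (p : M) (y v w : EuclideanSpace ℝ (Fin d)) :
    g.inChartForm p y v w = g.inChartForm p y w v := g.symm _ _ _

theorem inChartForm_nondegenerate {p : M} {y : EuclideanSpace ℝ (Fin d)}
    (hy : y ∈ (extChartAt (𝓡 d) p).target) {v : EuclideanSpace ℝ (Fin d)}
    (h : ∀ w, g.inChartForm p y v w = 0) : v = 0 := by
  have h1 : chartFrame p y v = 0 := by
    refine g.nondegenerate _ _ fun w => ?_
    have := h (chartCoframe p y w)
    rwa [inChartForm_apply, chartFrame_chartCoframe hy] at this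
  rw [← chartCoframe_chartFrame hy v, h1, map_zero]

theorem contDiffAt_inChartForm {p : M} {y : EuclideanSpace ℝ (Fin d)}
    (hy : y ∈ (extChartAt (𝓡 d) p).target) : ContDiffAt ℝ ∞ (g.inChartForm p) y := by
  refine (contDiffOn_clm_apply.2 fun v => contDiffOn_clm_apply.2 fun w => ?_).contDiffAt
    ((isOpen_extChartAt_target (I := 𝓡 d) p).mem_nhds hy)
  clear hy y
  intro y hy
  refine ContDiffAt.contDiffWithinAt ?_
  rw [← contMDiffAt_iff_contDiffAt]
  have h1 := (g.contMDiff _).comp y (contMDiffAt_chart_symm hy)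
  have h2 := ContMDiffAt.clm_bundle_apply₂ (F₃ := ℝ) (E₃ := fun _ : M => ℝ) h1
    (contMDiffAt_chartFrame hy v) (contMDiffAt_chartFrame hy w)
  exact (contMDiffAt_totalSpace.1 h2).2

end SemiRiemannianMetric

/-! ### Geodesics on a semi-Riemannian manifold -/

namespace SemiRiemannianMetric

variable {d : ℕ} {M : Type*} [TopologicalSpace M] [ChartedSpace (EuclideanSpace ℝ (Fin d)) M]
  [IsManifold (𝓡 d) ∞ M] (g : SemiRiemannianMetric d M)

/-- The curve `γ` satisfies the geodesic equation at time `t`, in the chart at `p`. -/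
def GeodesicEq (γ : ℝ → M) (p : M) (t : ℝ) : Prop :=
  ∀ w, geodesicResidual (g.inChartForm p) (extChartAt (𝓡 d) p (γ t))
    (deriv (fun s => extChartAt (𝓡 d) p (γ s)) t)
    (deriv (deriv fun s => extChartAt (𝓡 d) p (γ s)) t) w = 0

theorem inChart_add_christoffel {p : M} {y : EuclideanSpace ℝ (Fin d)}
    (hy : y ∈ (extChartAt (𝓡 d) p).target) (u a w : EuclideanSpace ℝ (Fin d)) :
    g.inChart p y a w + g.christoffel p y u u w
      = geodesicResidual (g.inChartForm p) y u a w := by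
  have hd : DifferentiableAt ℝ (g.inChartForm p) y :=
    (g.contDiffAt_inChartForm hy).differentiableAt (by simp)
  have h : ∀ v w b, fderiv ℝ (fun z => g.inChart p z v w) y b
      = fderiv ℝ (g.inChartForm p) y b v w := by
    intro v w b
    have := fderiv_clm_apply₂ hd (differentiableAt_const v) (differentiableAt_const w) b
    simpa [inChart_eq] using this
  simp only [christoffel, geodesicResidual, h]
  rw [inChart_eq]
  ring

theorem isGeodesicOn_iff_geodesicEq {γ : ℝ → M} {J : Set ℝ} :
    g.IsGeodesicOn γ J ↔ ContMDiffOn 𝓘(ℝ, ℝ) (𝓡 d) 2 γ J ∧ ∀ t ∈ J, ∀ p : M,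
      γ t ∈ (chartAt (EuclideanSpace ℝ (Fin d)) p).source → g.GeodesicEq γ p t := by
  refine and_congr_right fun _ => forall₂_congr fun t _ => forall₂_congr fun p hp =>
    forall_congr' fun w => ?_
  rw [inChart_add_christoffel g (mem_target_of_mem_source hp)]

theorem contDiffAt_chart_comp {γ : ℝ → M} {t : ℝ} {p : M}
    (hγ : ContMDiffAt 𝓘(ℝ, ℝ) (𝓡 d) 2 γ t)
    (hp : γ t ∈ (chartAt (EuclideanSpace ℝ (Fin d)) p).source) :
    ContDiffAt ℝ 2 (fun s => extChartAt (𝓡 d) p (γ s)) t := by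
  rw [← contMDiffAt_iff_contDiffAt]
  exact ContMDiffAt.comp t ((contMDiffAt_extChartAt' (n := ∞) hp).of_le two_le_infty) hγ

/-- The pullback of a metric under a map depends only on the germ of the map. -/
theorem val_mfderiv_congr {f₁ f₂ : EuclideanSpace ℝ (Fin d) → M} {z : EuclideanSpace ℝ (Fin d)}
    (h : f₁ =ᶠ[𝓝 z] f₂) (v w : EuclideanSpace ℝ (Fin d)) :
    g.val (f₁ z) (mfderiv 𝓘(ℝ, EuclideanSpace ℝ (Fin d)) (𝓡 d) f₁ z v)
        (mfderiv 𝓘(ℝ, EuclideanSpace ℝ (Fin d)) (𝓡 d) f₁ z w)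
      = g.val (f₂ z) (mfderiv 𝓘(ℝ, EuclideanSpace ℝ (Fin d)) (𝓡 d) f₂ z v)
        (mfderiv 𝓘(ℝ, EuclideanSpace ℝ (Fin d)) (𝓡 d) f₂ z w) := by
  have key : ∀ (x x' : M) (_ : x = x') (a b : EuclideanSpace ℝ (Fin d)),
      g.val x a b = g.val x' a b := by
    rintro x _ rfl a b
    rfl
  have h2 : (mfderiv 𝓘(ℝ, EuclideanSpace ℝ (Fin d)) (𝓡 d) f₁ z :
      EuclideanSpace ℝ (Fin d) →L[ℝ] EuclideanSpace ℝ (Fin d))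
      = mfderiv 𝓘(ℝ, EuclideanSpace ℝ (Fin d)) (𝓡 d) f₂ z := h.mfderiv_eq
  refine (key _ _ h.eq_of_nhds _ _).trans ?_
  exact congrArg (fun L : EuclideanSpace ℝ (Fin d) →L[ℝ] EuclideanSpace ℝ (Fin d) =>
    g.val (f₂ z) (L v) (L w)) h2

/-- Isometries preserve the geodesic equation, in whatever charts it is written. With the identity
as isometry, this is the independence of the equation from the chart. -/
theorem GeodesicEq.comp_isometry {F : M ≃ₜ M} (hF : F ∈ g.isometryGroup) {γ : ℝ → M} {t : ℝ}
    {p q : M} (hγ : ContMDiffAt 𝓘(ℝ, ℝ) (𝓡 d) 2 γ t)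
    (hp : γ t ∈ (chartAt (EuclideanSpace ℝ (Fin d)) p).source)
    (hq : F (γ t) ∈ (chartAt (EuclideanSpace ℝ (Fin d)) q).source)
    (h : g.GeodesicEq γ p t) : g.GeodesicEq (fun s => F (γ s)) q t := by
  obtain ⟨hF1, -, hF3⟩ := hF
  set θ : EuclideanSpace ℝ (Fin d) → EuclideanSpace ℝ (Fin d) :=
    fun z => extChartAt (𝓡 d) q (F ((extChartAt (𝓡 d) p).symm z)) with hθ
  set y := extChartAt (𝓡 d) p (γ t) with hy
  have hyt : y ∈ (extChartAt (𝓡 d) p).target := mem_target_of_mem_source hp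
  have hback : (extChartAt (𝓡 d) p).symm y = γ t :=
    (extChartAt (𝓡 d) p).left_inv (by rwa [extChartAt_source])
  have hgood : ∀ᶠ z in 𝓝 y, z ∈ (extChartAt (𝓡 d) p).target ∧
      F ((extChartAt (𝓡 d) p).symm z) ∈ (chartAt (EuclideanSpace ℝ (Fin d)) q).source := by
    refine Filter.Eventually.and ((isOpen_extChartAt_target (I := 𝓡 d) p).mem_nhds hyt) ?_
    have hc : ContinuousAt (fun z => F ((extChartAt (𝓡 d) p).symm z)) y :=
      F.continuous.continuousAt.comp (contMDiffAt_chart_symm hyt).continuousAt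
    refine hc.eventually ((chartAt _ q).open_source.mem_nhds ?_)
    beta_reduce
    rwa [hback]
  have hinner : ∀ z ∈ (extChartAt (𝓡 d) p).target,
      ContMDiffAt 𝓘(ℝ, EuclideanSpace ℝ (Fin d)) (𝓡 d) ∞
        (fun z => F ((extChartAt (𝓡 d) p).symm z)) z := fun z hz =>
    ContMDiffAt.comp z (hF1 _) (contMDiffAt_chart_symm hz)
  have hsmooth : ∀ z ∈ (extChartAt (𝓡 d) p).target,
      F ((extChartAt (𝓡 d) p).symm z) ∈ (chartAt (EuclideanSpace ℝ (Fin d)) q).source →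
      ContDiffAt ℝ ∞ θ z := by
    intro z hz hz'
    rw [← contMDiffAt_iff_contDiffAt]
    exact ContMDiffAt.comp z (contMDiffAt_extChartAt' hz') (hinner z hz)
  have hpull : ∀ᶠ z in 𝓝 y, ∀ v w, g.inChartForm p z v w
      = g.inChartForm q (θ z) (fderiv ℝ θ z v) (fderiv ℝ θ z w) := by
    filter_upwards [hgood.eventually_nhds] with z hz v w
    obtain ⟨hz1, hz2⟩ := hz.self_of_nhds
    have e : (fun z => (extChartAt (𝓡 d) q).symm (θ z))
        =ᶠ[𝓝 z] fun z => F ((extChartAt (𝓡 d) p).symm z) := by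
      filter_upwards [hz] with z' hz'
      exact (extChartAt (𝓡 d) q).left_inv (by rw [extChartAt_source]; exact hz'.2)
    have key := g.val_mfderiv_congr e v w
    have hθz : MDifferentiableAt 𝓘(ℝ, EuclideanSpace ℝ (Fin d))
        𝓘(ℝ, EuclideanSpace ℝ (Fin d)) θ z :=
      ((hsmooth z hz1 hz2).differentiableAt (by simp)).mdifferentiableAt
    have c1 : mfderiv 𝓘(ℝ, EuclideanSpace ℝ (Fin d)) (𝓡 d)
        (fun z => (extChartAt (𝓡 d) q).symm (θ z)) z
        = (chartFrame q (θ z)).comp (fderiv ℝ θ z) := by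
      rw [← mfderiv_eq_fderiv]
      exact mfderiv_comp z ((contMDiffAt_chart_symm
        (mem_target_of_mem_source hz2)).mdifferentiableAt (by simp)) hθz
    have c2 : mfderiv 𝓘(ℝ, EuclideanSpace ℝ (Fin d)) (𝓡 d)
        (fun z => F ((extChartAt (𝓡 d) p).symm z)) z
        = (mfderiv (𝓡 d) (𝓡 d) F ((extChartAt (𝓡 d) p).symm z)).comp (chartFrame p z) :=
      mfderiv_comp z (hF1.mdifferentiable (by simp) _)
        ((contMDiffAt_chart_symm hz1).mdifferentiableAt (by simp))
    rw [c1, c2] at key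
    exact (hF3 _ _ _).symm.trans key.symm
  have hθy : ContDiffAt ℝ ∞ θ y := hsmooth y hyt (by rwa [hback])
  have hθ2 : ContDiffAt ℝ 2 θ y := hθy.of_le two_le_infty
  have hθyt : θ y ∈ (extChartAt (𝓡 d) q).target := by
    rw [hθ]
    exact mem_target_of_mem_source (by rwa [hback])
  -- it suffices to test the equation on the image of `dθ`, which is everything
  have hsurj : Function.Surjective (fderiv ℝ θ y) := by
    have : Function.Injective (fderiv ℝ θ y).toLinearMap := by
      rw [injective_iff_map_eq_zero]
      intro v hv
      refine g.inChartForm_nondegenerate hyt fun w => ?_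
      rw [hpull.self_of_nhds]
      have hv' : fderiv ℝ θ y v = 0 := hv
      rw [hv', map_zero]
      rfl
    exact LinearMap.injective_iff_surjective.1 this
  have hcurve : (fun s => extChartAt (𝓡 d) q (F (γ s)))
      =ᶠ[𝓝 t] fun s => θ (extChartAt (𝓡 d) p (γ s)) := by
    filter_upwards [hγ.continuousAt.preimage_mem_nhds ((chartAt _ p).open_source.mem_nhds hp)]
      with s hs
    simp only [hθ]
    rw [(extChartAt (𝓡 d) p).left_inv (by rw [extChartAt_source]; exact hs)]
  obtain ⟨e1, e2⟩ := deriv_deriv_comp (c := fun s => extChartAt (𝓡 d) p (γ s)) hθ2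
    (contDiffAt_chart_comp hγ hp)
  intro w
  obtain ⟨w, rfl⟩ := hsurj w
  have hx : extChartAt (𝓡 d) q (F (γ t)) = θ y := hcurve.self_of_nhds
  rw [hx, hcurve.deriv_eq, hcurve.deriv.deriv_eq, e1, e2,
    ← geodesicResidual_pullback hθ2 ((g.contDiffAt_inChartForm hθyt).differentiableAt (by simp))
      hpull ((g.contDiffAt_inChartForm hyt).differentiableAt (by simp))
      (fun v w => g.inChartForm_symm q _ v w)]
  exact h w

/-- A `C²` curve satisfying the geodesic equation in some chart at each time is a geodesic. -/
theorem isGeodesicOn_of_exists_chart {γ : ℝ → M} {J : Set ℝ} (hJ : IsOpen J)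
    (hγ : ContMDiffOn 𝓘(ℝ, ℝ) (𝓡 d) 2 γ J)
    (h : ∀ t ∈ J, ∃ p, γ t ∈ (chartAt (EuclideanSpace ℝ (Fin d)) p).source ∧
      g.GeodesicEq γ p t) : g.IsGeodesicOn γ J := by
  refine g.isGeodesicOn_iff_geodesicEq.2 ⟨hγ, fun t ht q hq => ?_⟩
  obtain ⟨p, hp, hpe⟩ := h t ht
  exact hpe.comp_isometry g g.isometryGroup.one_mem (hγ.contMDiffAt (hJ.mem_nhds ht)) hp hq

theorem IsGeodesicOn.comp_isometry {F : M ≃ₜ M} (hF : F ∈ g.isometryGroup) {γ : ℝ → M}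
    {J : Set ℝ} (hJ : IsOpen J) (h : g.IsGeodesicOn γ J) :
    g.IsGeodesicOn (fun s => F (γ s)) J := by
  obtain ⟨h1, h2⟩ := g.isGeodesicOn_iff_geodesicEq.1 h
  refine g.isGeodesicOn_iff_geodesicEq.2 ⟨(hF.1.of_le two_le_infty).comp_contMDiffOn h1,
    fun t ht q hq => ?_⟩
  exact (h2 t ht _ (mem_chart_source _ _)).comp_isometry g hF (h1.contMDiffAt (hJ.mem_nhds ht))
    (mem_chart_source _ _) hq

/-- Affine reparametrizations of geodesics are geodesics. -/
theorem IsGeodesicOn.comp_affine {γ : ℝ → M} {J J' : Set ℝ} (h : g.IsGeodesicOn γ J) (b k : ℝ)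
    (hJ : ∀ s ∈ J', b + k * s ∈ J) : g.IsGeodesicOn (fun s => γ (b + k * s)) J' := by
  obtain ⟨h1, h2⟩ := g.isGeodesicOn_iff_geodesicEq.1 h
  have hsm : ContMDiff 𝓘(ℝ, ℝ) 𝓘(ℝ, ℝ) 2 (fun s : ℝ => b + k * s) := by
    rw [contMDiff_iff_contDiff]
    fun_prop
  refine g.isGeodesicOn_iff_geodesicEq.2 ⟨h1.comp hsm.contMDiffOn hJ, fun t ht p hp w => ?_⟩
  have hder : ∀ c : ℝ → EuclideanSpace ℝ (Fin d),
      (deriv fun s => c (b + k * s)) = fun s => k • deriv c (b + k * s) := by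
    intro c
    funext s
    rw [deriv_comp_mul_left k (fun x => c (b + x)) s, deriv_comp_const_add]
  have h3 := h2 _ (hJ t ht) p hp w
  have e1 := hder fun s => extChartAt (𝓡 d) p (γ s)
  have e2 : deriv (deriv fun s => extChartAt (𝓡 d) p (γ (b + k * s))) t
      = k • k • deriv (deriv fun s => extChartAt (𝓡 d) p (γ s)) (b + k * t) := by
    rw [e1, deriv_fun_const_smul_field, hder]
  rw [e2, e1]
  simp only [geodesicResidual, map_smul, _root_.smul_apply, smul_eq_mul] at h3 ⊢
  linear_combination k * k * h3

end SemiRiemannianMetric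

/-! ### Existence and uniqueness of geodesics -/

namespace SemiRiemannianMetric

variable {d : ℕ} {M : Type*} [TopologicalSpace M] [ChartedSpace (EuclideanSpace ℝ (Fin d)) M]
  [IsManifold (𝓡 d) ∞ M] (g : SemiRiemannianMetric d M)

theorem contDiffAt_acceleration {p : M} {y : EuclideanSpace ℝ (Fin d)}
    (hy : y ∈ (extChartAt (𝓡 d) p).target) :
    ContDiffAt ℝ 1 (geodesicAcceleration (g.inChartForm p)) y :=
  contDiffAt_geodesicAcceleration ((g.contDiffAt_inChartForm hy).of_le two_le_infty)
    fun _ => g.inChartForm_nondegenerate hy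

theorem geodesicEq_iff {γ : ℝ → M} {p : M} {t : ℝ}
    (hp : γ t ∈ (chartAt (EuclideanSpace ℝ (Fin d)) p).source) :
    g.GeodesicEq γ p t ↔ deriv (deriv fun s => extChartAt (𝓡 d) p (γ s)) t
      = geodesicAcceleration (g.inChartForm p) (extChartAt (𝓡 d) p (γ t))
        (deriv (fun s => extChartAt (𝓡 d) p (γ s)) t)
        (deriv (fun s => extChartAt (𝓡 d) p (γ s)) t) :=
  geodesicResidual_eq_zero_iff
    (fun _ => g.inChartForm_nondegenerate (mem_target_of_mem_source hp)) _ _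

/-- The curve of positions and velocities of a geodesic, in a chart, solves the geodesic system. -/
theorem IsGeodesicOn.hasDerivAt_chart {γ : ℝ → M} {J : Set ℝ} (hJ : IsOpen J)
    (h : g.IsGeodesicOn γ J) {t : ℝ} (ht : t ∈ J) {p : M}
    (hp : γ t ∈ (chartAt (EuclideanSpace ℝ (Fin d)) p).source) :
    HasDerivAt (fun s => (extChartAt (𝓡 d) p (γ s), deriv (fun s => extChartAt (𝓡 d) p (γ s)) s))
      (secondOrderField (geodesicAcceleration (g.inChartForm p))
        (extChartAt (𝓡 d) p (γ t), deriv (fun s => extChartAt (𝓡 d) p (γ s)) t)) t := by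
  obtain ⟨h1, h2⟩ := g.isGeodesicOn_iff_geodesicEq.1 h
  obtain ⟨k1, k2⟩ := hasDerivAt_deriv_of_contDiffAt
    (contDiffAt_chart_comp (h1.contMDiffAt (hJ.mem_nhds ht)) hp)
  rw [(g.geodesicEq_iff hp).1 (h2 t ht p hp)] at k2
  exact k1.prodMk k2

omit [IsManifold (𝓡 d) ∞ M] in
theorem eventually_mem_source {γ : ℝ → M} {J : Set ℝ} (hJ : IsOpen J)
    (h : ContinuousOn γ J) {t : ℝ} (ht : t ∈ J) {p : M}
    (hp : γ t ∈ (chartAt (EuclideanSpace ℝ (Fin d)) p).source) :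
    ∀ᶠ s in 𝓝 t, s ∈ J ∧ γ s ∈ (chartAt (EuclideanSpace ℝ (Fin d)) p).source :=
  Filter.Eventually.and (hJ.mem_nhds ht)
    ((h.continuousAt (hJ.mem_nhds ht)).preimage_mem_nhds ((chartAt _ p).open_source.mem_nhds hp))

/-- Local uniqueness of geodesics. -/
theorem IsGeodesicOn.eventuallyEq {γ₁ γ₂ : ℝ → M} {J : Set ℝ} (hJ : IsOpen J)
    (h₁ : g.IsGeodesicOn γ₁ J) (h₂ : g.IsGeodesicOn γ₂ J) {t : ℝ} (ht : t ∈ J) {p : M}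
    (hp : γ₁ t ∈ (chartAt (EuclideanSpace ℝ (Fin d)) p).source) (h : γ₁ t = γ₂ t)
    (h' : deriv (fun s => extChartAt (𝓡 d) p (γ₁ s)) t
      = deriv (fun s => extChartAt (𝓡 d) p (γ₂ s)) t) : γ₁ =ᶠ[𝓝 t] γ₂ := by
  have e₁ := eventually_mem_source hJ h₁.1.continuousOn ht hp
  have e₂ := eventually_mem_source hJ h₂.1.continuousOn ht (h ▸ hp)
  have key := eventuallyEq_of_hasDerivAt
    (f := secondOrderField (geodesicAcceleration (g.inChartForm p)))
    (c₁ := fun s => (extChartAt (𝓡 d) p (γ₁ s), deriv (fun s => extChartAt (𝓡 d) p (γ₁ s)) s))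
    (c₂ := fun s => (extChartAt (𝓡 d) p (γ₂ s), deriv (fun s => extChartAt (𝓡 d) p (γ₂ s)) s))
    (contDiffAt_secondOrderField (g.contDiffAt_acceleration (mem_target_of_mem_source hp)))
    (e₁.mono fun s hs => h₁.hasDerivAt_chart g hJ hs.1 hs.2)
    (e₂.mono fun s hs => h₂.hasDerivAt_chart g hJ hs.1 hs.2)
    (by simp only [h, h'])
  filter_upwards [key, e₁, e₂] with s hs hs₁ hs₂
  exact (extChartAt (𝓡 d) p).injOn (by rw [extChartAt_source]; exact hs₁.2)
    (by rw [extChartAt_source]; exact hs₂.2) (congrArg Prod.fst hs)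

/-- Two geodesics on an interval that agree near one time agree on the whole interval. -/
theorem IsGeodesicOn.eqOn [T2Space M] {γ₁ γ₂ : ℝ → M} {J : Set ℝ} (hJ : IsOpen J)
    (hJc : IsPreconnected J) (h₁ : g.IsGeodesicOn γ₁ J) (h₂ : g.IsGeodesicOn γ₂ J) {t₀ : ℝ}
    (ht₀ : t₀ ∈ J) (h : γ₁ =ᶠ[𝓝 t₀] γ₂) : EqOn γ₁ γ₂ J := by
  -- the set of times near which the geodesics agree is open and, by local uniqueness, closed in `J`
  have hsub : J ⊆ {t | γ₁ =ᶠ[𝓝 t] γ₂} := by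
    refine hJc.subset_of_closure_inter_subset isOpen_setOfPred_eventually_nhds ⟨t₀, ht₀, h⟩ ?_
    rintro t ⟨htc, ht⟩
    have hfr : ∃ᶠ s in 𝓝 t, γ₁ =ᶠ[𝓝 s] γ₂ := mem_closure_iff_frequently.1 htc
    have c₁ := h₁.1.continuousOn.continuousAt (hJ.mem_nhds ht)
    have c₂ := h₂.1.continuousOn.continuousAt (hJ.mem_nhds ht)
    have heq : γ₁ t = γ₂ t := tendsto_nhds_unique_of_frequently_eq c₁ c₂
      (hfr.mono fun s hs => hs.self_of_nhds)
    have hp : γ₁ t ∈ (chartAt (EuclideanSpace ℝ (Fin d)) (γ₁ t)).source := mem_chart_source _ _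
    refine h₁.eventuallyEq g hJ h₂ ht hp heq ?_
    have d₁ := (h₁.hasDerivAt_chart g hJ ht hp).continuousAt.snd
    have d₂ := (h₂.hasDerivAt_chart g hJ ht (p := γ₁ t) (heq ▸ hp)).continuousAt.snd
    refine tendsto_nhds_unique_of_frequently_eq d₁ d₂ (hfr.mono fun s hs => ?_)
    have : (fun s => extChartAt (𝓡 d) (γ₁ t) (γ₁ s))
        =ᶠ[𝓝 s] fun s => extChartAt (𝓡 d) (γ₁ t) (γ₂ s) := by
      filter_upwards [hs] with s' hs'
      rw [hs']
    exact this.deriv_eq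
  exact fun t ht => (hsub ht).self_of_nhds

/-- Geodesics with small initial velocity at `p` exist for a uniform time, stay in the chart at `p`,
and their position at a fixed time depends on the initial velocity with an invertible strict
derivative at `0`. -/
theorem exists_geodesics (p : M) : ∃ a > (0 : ℝ), ∃ t₁ ∈ Ioo 0 a, ∃ r > (0 : ℝ),
    ∃ γ : EuclideanSpace ℝ (Fin d) → ℝ → M,
      (∀ v ∈ ball (0 : EuclideanSpace ℝ (Fin d)) r, γ v 0 = p ∧
        deriv (fun s => extChartAt (𝓡 d) p (γ v s)) 0 = v ∧
        (∀ t ∈ Ioo (-a) a, γ v t ∈ (chartAt (EuclideanSpace ℝ (Fin d)) p).source) ∧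
        g.IsGeodesicOn (γ v) (Ioo (-a) a)) ∧
      γ 0 t₁ = p ∧
      HasStrictFDerivAt (fun v => extChartAt (𝓡 d) p (γ v t₁))
        (t₁ • ContinuousLinearMap.id ℝ (EuclideanSpace ℝ (Fin d))) 0 := by
  have hp : extChartAt (𝓡 d) p p ∈ (extChartAt (𝓡 d) p).target := mem_extChartAt_target p
  have hN : (extChartAt (𝓡 d) p).target ×ˢ (univ : Set (EuclideanSpace ℝ (Fin d)))
      ∈ 𝓝 (extChartAt (𝓡 d) p p, (0 : EuclideanSpace ℝ (Fin d))) :=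
    prod_mem_nhds ((isOpen_extChartAt_target (I := 𝓡 d) p).mem_nhds hp) Filter.univ_mem
  obtain ⟨a, ha, t₁, ht₁, r, hr, α, hα, hstrict, hα0⟩ :=
    exists_exponential (g.contDiffAt_acceleration hp) hN
  have ht₁' : t₁ ∈ Ioo (-a) a := ⟨by linarith [ht₁.1], ht₁.2⟩
  have h0 : (0 : ℝ) ∈ Ioo (-a) a := ⟨by linarith, ha⟩
  have htgt : ∀ v ∈ ball (0 : EuclideanSpace ℝ (Fin d)) r, ∀ t ∈ Ioo (-a) a,
      (α v t).1 ∈ (extChartAt (𝓡 d) p).target := fun v hv t ht => ((hα v hv).2 t ht).2.1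
  have hpos : ∀ v ∈ ball (0 : EuclideanSpace ℝ (Fin d)) r, ∀ t ∈ Ioo (-a) a,
      extChartAt (𝓡 d) p ((extChartAt (𝓡 d) p).symm (α v t).1) = (α v t).1 := fun v hv t ht =>
    (extChartAt (𝓡 d) p).right_inv (htgt v hv t ht)
  refine ⟨a, ha, t₁, ht₁, r, hr, fun v t => (extChartAt (𝓡 d) p).symm (α v t).1,
    fun v hv => ?_, ?_, ?_⟩
  · have hd1 : ∀ t ∈ Ioo (-a) a, HasDerivAt (fun s => (α v s).1) (α v t).2 t := fun t ht => by
      have := ((hα v hv).2 t ht).1.hasFDerivAt.fst.hasDerivAt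
      simpa [secondOrderField] using this
    have hd2 : ∀ t ∈ Ioo (-a) a, HasDerivAt (fun s => (α v s).2)
        (geodesicAcceleration (g.inChartForm p) (α v t).1 (α v t).2 (α v t).2) t := fun t ht => by
      have := ((hα v hv).2 t ht).1.hasFDerivAt.snd.hasDerivAt
      simpa [secondOrderField] using this
    have hev : ∀ t ∈ Ioo (-a) a, (fun s => extChartAt (𝓡 d) p ((extChartAt (𝓡 d) p).symm (α v s).1))
        =ᶠ[𝓝 t] fun s => (α v s).1 := fun t ht => by
      filter_upwards [isOpen_Ioo.mem_nhds ht] with s hs using hpos v hv s hs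
    have hev' : ∀ t ∈ Ioo (-a) a,
        (deriv fun s => extChartAt (𝓡 d) p ((extChartAt (𝓡 d) p).symm (α v s).1))
        =ᶠ[𝓝 t] fun s => (α v s).2 := fun t ht => by
      filter_upwards [isOpen_Ioo.mem_nhds ht] with s hs
      rw [(hev s hs).deriv_eq, (hd1 s hs).deriv]
    have hsrc : ∀ t ∈ Ioo (-a) a, (extChartAt (𝓡 d) p).symm (α v t).1
        ∈ (chartAt (EuclideanSpace ℝ (Fin d)) p).source := fun t ht => by
      have := (extChartAt (𝓡 d) p).map_target (htgt v hv t ht)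
      rwa [extChartAt_source] at this
    refine ⟨?_, ?_, hsrc, ?_⟩
    · simp only [(hα v hv).1, extChartAt_to_inv]
    · rw [(hev' 0 h0).eq_of_nhds, (hα v hv).1]
    · refine g.isGeodesicOn_of_exists_chart isOpen_Ioo ?_ fun t ht => ⟨p, hsrc t ht, ?_⟩
      · -- the solution is of class `C²` since its velocity is of class `C¹`
        have hαc : ContDiffOn ℝ 2 (fun s => (α v s).1) (Ioo (-a) a) := by
          have h2 : ContDiffOn ℝ 1 (fun s => (α v s).2) (Ioo (-a) a) := by
            have h3 : ContinuousOn (fun t => geodesicAcceleration (g.inChartForm p) (α v t).1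
                (α v t).2 (α v t).2) (Ioo (-a) a) := by
              intro t ht
              have c1 := (hd1 t ht).continuousAt
              have c2 := (hd2 t ht).continuousAt
              have c3 : ContinuousAt
                  (fun t => geodesicAcceleration (g.inChartForm p) (α v t).1) t :=
                ContinuousAt.comp (g := geodesicAcceleration (g.inChartForm p))
                  (g.contDiffAt_acceleration (htgt v hv t ht)).continuousAt c1
              exact ((c3.clm_apply c2).clm_apply c2).continuousWithinAt
            have e1 : (1 : WithTop ℕ∞) = 0 + 1 := by norm_num
            rw [e1, contDiffOn_succ_iff_deriv_of_isOpen isOpen_Ioo, contDiffOn_zero]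
            exact ⟨fun t ht => (hd2 t ht).differentiableAt.differentiableWithinAt, by simp,
              h3.congr fun t ht => (hd2 t ht).deriv⟩
          have e2 : (2 : WithTop ℕ∞) = 1 + 1 := by norm_num
          rw [e2, contDiffOn_succ_iff_deriv_of_isOpen isOpen_Ioo]
          exact ⟨fun t ht => (hd1 t ht).differentiableAt.differentiableWithinAt, by simp,
            h2.congr fun t ht => (hd1 t ht).deriv⟩
        exact ContMDiffOn.comp ((contMDiffOn_extChartAt_symm (n := ∞) p).of_le two_le_infty)
          hαc.contMDiffOn fun t ht => htgt v hv t ht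
      · rw [g.geodesicEq_iff (hsrc t ht), (hev' t ht).deriv_eq, (hd2 t ht).deriv,
          (hev' t ht).eq_of_nhds, hpos v hv t ht]
  · simp only [hα0, extChartAt_to_inv]
  · refine hstrict.congr_of_eventuallyEq ?_
    filter_upwards [ball_mem_nhds (0 : EuclideanSpace ℝ (Fin d)) hr] with v hv
    exact (hpos v hv t₁ ht₁').symm

end SemiRiemannianMetric

/-! ### Vector fields in charts -/

section Fields

variable {d : ℕ} {M : Type*} [TopologicalSpace M] [ChartedSpace (EuclideanSpace ℝ (Fin d)) M]
  [IsManifold (𝓡 d) ∞ M]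

/-- The coordinates of a smooth vector field are smooth. -/
theorem contDiffAt_chartCoframe {V : Π x : M, TangentSpace (𝓡 d) x} {p : M}
    {y : EuclideanSpace ℝ (Fin d)} (hy : y ∈ (extChartAt (𝓡 d) p).target)
    (hV : ContMDiffAt (𝓡 d) (𝓡 d).tangent ∞
      (fun x => (⟨x, V x⟩ : TangentBundle (𝓡 d) M)) ((extChartAt (𝓡 d) p).symm y)) :
    ContDiffAt ℝ ∞ (fun z => chartCoframe p z (V ((extChartAt (𝓡 d) p).symm z))) y :=
  contMDiffAt_vectorSpace_iff_contDiffAt.1 <|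
    ContMDiffAt.mpullback_vectorField_preimage hV (contMDiffAt_chart_symm hy)
      (isInvertible_chartFrame hy) le_rfl

/-- The coordinate fields of a chart extend, from a neighbourhood of any point of the chart, to
smooth vector fields on the whole manifold. -/
theorem exists_isSmoothVectorField_eq_chartFrame [T2Space M] {p : M}
    {y : EuclideanSpace ℝ (Fin d)} (hy : y ∈ (extChartAt (𝓡 d) p).target)
    (u : EuclideanSpace ℝ (Fin d)) : ∃ X : Π x : M, TangentSpace (𝓡 d) x,
      IsSmoothVectorField X ∧
      ∀ᶠ z in 𝓝 y, X ((extChartAt (𝓡 d) p).symm z) = chartFrame p z u := by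
  have hsrc : (chartAt (EuclideanSpace ℝ (Fin d)) p).source ∈ 𝓝 ((extChartAt (𝓡 d) p).symm y) := by
    refine (chartAt _ p).open_source.mem_nhds ?_
    rw [← extChartAt_source (𝓡 d)]
    exact (extChartAt (𝓡 d) p).map_target hy
  obtain ⟨f, -, hf⟩ := (SmoothBumpFunction.nhds_basis_tsupport (I := 𝓡 d)
    ((extChartAt (𝓡 d) p).symm y)).mem_iff.1 hsrc
  -- the coordinate field, cut off by a bump function supported in the chart
  let V : Π x : M, TangentSpace (𝓡 d) x := VectorField.mpullback (𝓡 d)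
    𝓘(ℝ, EuclideanSpace ℝ (Fin d)) (extChartAt (𝓡 d) p) (fun _ => u)
  have hV : ContMDiffOn (𝓡 d) (𝓡 d).tangent ∞ (fun x => (⟨x, V x⟩ : TangentBundle (𝓡 d) M))
      (chartAt (EuclideanSpace ℝ (Fin d)) p).source := by
    intro x hx
    have hc : ContMDiffAt 𝓘(ℝ, EuclideanSpace ℝ (Fin d)) 𝓘(ℝ, EuclideanSpace ℝ (Fin d)).tangent ∞
      (fun y => (⟨y, u⟩ : TangentBundle 𝓘(ℝ, EuclideanSpace ℝ (Fin d)) _))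
      (extChartAt (𝓡 d) p x) := contMDiffAt_vectorSpace_iff_contDiffAt.2 contDiffAt_const
    exact (ContMDiffAt.mpullback_vectorField_preimage hc
      (contMDiffAt_extChartAt' (n := ∞) hx)
      (isInvertible_mfderiv_extChartAt (by rwa [extChartAt_source])) le_rfl).contMDiffWithinAt
  refine ⟨(f : M → ℝ) • V, ContMDiffOn.smul_section_of_tsupport f.contMDiff.contMDiffOn
    (chartAt _ p).open_source hf hV, ?_⟩
  have h1 := (contMDiffAt_chart_symm hy).continuousAt.eventually f.eventuallyEq_one
  filter_upwards [h1, (isOpen_extChartAt_target (I := 𝓡 d) p).mem_nhds hy] with z hz hzt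
  have hzs := (extChartAt (𝓡 d) p).map_target hzt
  have hzs' : (extChartAt (𝓡 d) p).symm z ∈ (chartAt (EuclideanSpace ℝ (Fin d)) p).source := by
    rwa [extChartAt_source] at hzs
  have hinv : mfderiv (𝓡 d) 𝓘(ℝ, EuclideanSpace ℝ (Fin d)) (extChartAt (𝓡 d) p)
      ((extChartAt (𝓡 d) p).symm z) (chartFrame p z u) = u := by
    have h2 := mfderiv_comp_apply z ((contMDiffAt_extChartAt' (I := 𝓡 d) (n := 1)
      hzs').mdifferentiableAt (by simp))
      ((contMDiffAt_chart_symm hzt).mdifferentiableAt (by simp)) u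
    have h3 : (extChartAt (𝓡 d) p : M → EuclideanSpace ℝ (Fin d)) ∘ (extChartAt (𝓡 d) p).symm
        =ᶠ[𝓝 z] id := by
      filter_upwards [(isOpen_extChartAt_target (I := 𝓡 d) p).mem_nhds hzt] with w hw
      exact (extChartAt (𝓡 d) p).right_inv hw
    rw [h3.mfderiv_eq, mfderiv_id] at h2
    exact h2.symm
  change f ((extChartAt (𝓡 d) p).symm z) • V _ = _
  rw [hz, Pi.one_apply, one_smul]
  have h4 := (isInvertible_mfderiv_extChartAt (I := 𝓡 d) hzs).inverse_apply_self (chartFrame p z u)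
  rw [hinv] at h4
  exact h4

/-- The Lie bracket of two vector fields, in a chart. -/
theorem chartCoframe_mlieBracket {V W : Π x : M, TangentSpace (𝓡 d) x} {p : M}
    {y : EuclideanSpace ℝ (Fin d)} (hy : y ∈ (extChartAt (𝓡 d) p).target)
    (hV : IsSmoothVectorField V) (hW : IsSmoothVectorField W)
    {v w : EuclideanSpace ℝ (Fin d) → EuclideanSpace ℝ (Fin d)}
    (hv : ∀ᶠ z in 𝓝 y, chartCoframe p z (V ((extChartAt (𝓡 d) p).symm z)) = v z)
    (hw : ∀ᶠ z in 𝓝 y, chartCoframe p z (W ((extChartAt (𝓡 d) p).symm z)) = w z) :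
    chartCoframe p y (VectorField.mlieBracket (𝓡 d) V W ((extChartAt (𝓡 d) p).symm y))
      = fderiv ℝ w y (v y) - fderiv ℝ v y (w y) := by
  have : IsManifold (𝓡 d) (minSmoothness ℝ 3) M :=
    IsManifold.of_le (m := minSmoothness ℝ 3) (n := ∞) (by
      rw [minSmoothness_of_isRCLikeNormedField]; exact WithTop.coe_le_coe.2 (le_top : (3 : ℕ∞) ≤ ⊤))
  have h := VectorField.mpullback_mlieBracket (I := 𝓘(ℝ, EuclideanSpace ℝ (Fin d))) (I' := 𝓡 d)
    (n := ∞) ((hV ((extChartAt (𝓡 d) p).symm y)).mdifferentiableAt (by simp))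
    ((hW ((extChartAt (𝓡 d) p).symm y)).mdifferentiableAt (by simp)) (contMDiffAt_chart_symm hy)
    (by rw [minSmoothness_of_isRCLikeNormedField]; exact two_le_infty)
  refine h.trans ((Filter.EventuallyEq.mlieBracket_vectorField_eq hv hw).trans ?_)
  have h₁ := congrFun (VectorField.mlieBracketWithin_univ (I := 𝓘(ℝ, EuclideanSpace ℝ (Fin d)))
    (V := v) (W := w)) y
  have h₂ := congrFun (VectorField.mlieBracketWithin_eq_lieBracketWithin
    (E := EuclideanSpace ℝ (Fin d)) (𝕜 := ℝ) (V := v) (W := w) (s := univ)) y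
  exact h₁.symm.trans (h₂.trans (congrFun (VectorField.lieBracketWithin_univ (V := v) (W := w)) y))

end Fields

/-! ### Para-contact metric structures in charts: the Reeb field is Killing -/

namespace ParaContactMetricStructure

variable {n : ℕ} {M : Type*} [TopologicalSpace M]
  [ChartedSpace (EuclideanSpace ℝ (Fin (2 * n + 1))) M] [IsManifold (𝓡 (2 * n + 1)) ∞ M]
  (S : ParaContactMetricStructure n M)

/-- The contact form in the chart at `p`. -/
noncomputable def ηInChart (p : M) (y : EuclideanSpace ℝ (Fin (2 * n + 1))) :
    EuclideanSpace ℝ (Fin (2 * n + 1)) →L[ℝ] ℝ :=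
  (S.η _) ∘L (chartFrame p y)

/-- The Reeb vector field in the chart at `p`. -/
noncomputable def ξInChart (p : M) (y : EuclideanSpace ℝ (Fin (2 * n + 1))) :
    EuclideanSpace ℝ (Fin (2 * n + 1)) :=
  chartCoframe p y (S.ξ _)

/-- The `(1,1)`-tensor `φ` in the chart at `p`. -/
noncomputable def φInChart (p : M) (y : EuclideanSpace ℝ (Fin (2 * n + 1))) :
    EuclideanSpace ℝ (Fin (2 * n + 1)) →L[ℝ] EuclideanSpace ℝ (Fin (2 * n + 1)) :=
  chartCoframe p y ∘L (S.φ _) ∘L (chartFrame p y)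

theorem ηInChart_apply (p : M) (y v : EuclideanSpace ℝ (Fin (2 * n + 1))) :
    S.ηInChart p y v = S.η ((extChartAt (𝓡 (2 * n + 1)) p).symm y) (chartFrame p y v) := rfl

theorem φInChart_apply (p : M) (y v : EuclideanSpace ℝ (Fin (2 * n + 1))) :
    S.φInChart p y v
      = chartCoframe p y (S.φ ((extChartAt (𝓡 (2 * n + 1)) p).symm y) (chartFrame p y v)) := rfl

section Point

variable {p : M} {y : EuclideanSpace ℝ (Fin (2 * n + 1))}
  (hy : y ∈ (extChartAt (𝓡 (2 * n + 1)) p).target)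
include hy

theorem chartFrame_ξInChart : chartFrame p y (S.ξInChart p y) = S.ξ _ :=
  chartFrame_chartCoframe hy _

theorem chartFrame_φInChart (v : EuclideanSpace ℝ (Fin (2 * n + 1))) :
    chartFrame p y (S.φInChart p y v) = S.φ _ (chartFrame p y v) :=
  chartFrame_chartCoframe hy _

theorem ηInChart_ξInChart : S.ηInChart p y (S.ξInChart p y) = 1 := by
  rw [ηInChart_apply, S.chartFrame_ξInChart hy, S.η_ξ]

theorem φInChart_φInChart (v : EuclideanSpace ℝ (Fin (2 * n + 1))) :
    S.φInChart p y (S.φInChart p y v) = v - S.ηInChart p y v • S.ξInChart p y := by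
  rw [φInChart_apply, S.chartFrame_φInChart hy, S.φ_sq, map_sub, map_smul,
    chartCoframe_chartFrame hy]
  rfl

theorem inChartForm_φInChart (v w : EuclideanSpace ℝ (Fin (2 * n + 1))) :
    S.g.inChartForm p y (S.φInChart p y v) (S.φInChart p y w)
      = - S.g.inChartForm p y v w + S.ηInChart p y v * S.ηInChart p y w := by
  rw [SemiRiemannianMetric.inChartForm_apply, S.chartFrame_φInChart hy, S.chartFrame_φInChart hy,
    S.g_φ]
  rfl

theorem contDiffAt_ξInChart : ContDiffAt ℝ ∞ (S.ξInChart p) y :=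
  contDiffAt_chartCoframe hy (S.contMDiff_ξ _)

end Point

theorem contDiffAt_ηInChart {p : M} {y : EuclideanSpace ℝ (Fin (2 * n + 1))}
    (hy : y ∈ (extChartAt (𝓡 (2 * n + 1)) p).target) : ContDiffAt ℝ ∞ (S.ηInChart p) y := by
  refine (contDiffOn_clm_apply.2 fun v => ?_).contDiffAt
    ((isOpen_extChartAt_target (I := 𝓡 (2 * n + 1)) p).mem_nhds hy)
  clear hy y
  intro y hy
  refine ContDiffAt.contDiffWithinAt ?_
  rw [← contMDiffAt_iff_contDiffAt]
  have h1 := (S.contMDiff_η _).comp y (contMDiffAt_chart_symm hy)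
  have h2 := ContMDiffAt.clm_bundle_apply (F₂ := ℝ) (E₂ := fun _ : M => ℝ) h1
    (contMDiffAt_chartFrame hy v)
  exact (contMDiffAt_totalSpace.1 h2).2

theorem isSmoothVectorField_φ {X : Π x : M, TangentSpace (𝓡 (2 * n + 1)) x}
    (hX : IsSmoothVectorField X) : IsSmoothVectorField fun x => S.φ x (X x) := fun x =>
  ContMDiffAt.clm_bundle_apply (S.contMDiff_φ x) (hX x)

theorem contMDiff_η_apply {X : Π x : M, TangentSpace (𝓡 (2 * n + 1)) x}
    (hX : IsSmoothVectorField X) :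
    ContMDiff (𝓡 (2 * n + 1)) 𝓘(ℝ, ℝ) ∞ fun x => S.η x (X x) := fun x => by
  have h2 := ContMDiffAt.clm_bundle_apply (F₂ := ℝ) (E₂ := fun _ : M => ℝ) (S.contMDiff_η x) (hX x)
  exact (contMDiffAt_totalSpace.1 h2).2

theorem contDiffAt_φInChart {p : M} {y : EuclideanSpace ℝ (Fin (2 * n + 1))}
    (hy : y ∈ (extChartAt (𝓡 (2 * n + 1)) p).target) [T2Space M] :
    ContDiffAt ℝ ∞ (S.φInChart p) y := by
  refine (contDiffOn_clm_apply.2 fun v => ?_).contDiffAt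
    ((isOpen_extChartAt_target (I := 𝓡 (2 * n + 1)) p).mem_nhds hy)
  clear hy y
  intro y hy
  obtain ⟨X, hX, hXe⟩ := exists_isSmoothVectorField_eq_chartFrame hy v
  refine ContDiffAt.contDiffWithinAt ?_
  refine (contDiffAt_chartCoframe hy (S.isSmoothVectorField_φ hX _)).congr_of_eventuallyEq ?_
  filter_upwards [hXe] with z hz
  rw [φInChart_apply, hz]

/-- The derivative of a function given by a contraction with `η` along a coordinate field. -/
theorem mvfderiv_η_apply {p : M} {y : EuclideanSpace ℝ (Fin (2 * n + 1))}
    (hy : y ∈ (extChartAt (𝓡 (2 * n + 1)) p).target)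
    {Y : Π x : M, TangentSpace (𝓡 (2 * n + 1)) x} (hY : IsSmoothVectorField Y)
    {v : EuclideanSpace ℝ (Fin (2 * n + 1))}
    (hYe : ∀ᶠ z in 𝓝 y, Y ((extChartAt (𝓡 (2 * n + 1)) p).symm z) = chartFrame p z v)
    (u : EuclideanSpace ℝ (Fin (2 * n + 1))) :
    mvfderiv (𝓡 (2 * n + 1)) (fun x => S.η x (Y x)) ((extChartAt (𝓡 (2 * n + 1)) p).symm y)
      (chartFrame p y u) = fderiv ℝ (S.ηInChart p) y u v := by
  have h := mvfderiv_comp_apply y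
    ((S.contMDiff_η_apply hY ((extChartAt (𝓡 (2 * n + 1)) p).symm y)).mdifferentiableAt (by simp))
    ((contMDiffAt_chart_symm hy).mdifferentiableAt (by simp)) u
  refine h.symm.trans ?_
  have he : (fun x => S.η x (Y x)) ∘ (extChartAt (𝓡 (2 * n + 1)) p).symm
      =ᶠ[𝓝 y] fun z => S.ηInChart p z v := by
    filter_upwards [hYe] with z hz
    simp only [Function.comp]
    rw [hz, ηInChart_apply]
  have h3 : mfderiv 𝓘(ℝ, EuclideanSpace ℝ (Fin (2 * n + 1))) 𝓘(ℝ, ℝ)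
      ((fun x => S.η x (Y x)) ∘ (extChartAt (𝓡 (2 * n + 1)) p).symm) y
      = fderiv ℝ (fun z => S.ηInChart p z v) y := by
    rw [he.mfderiv_eq]
    exact mfderiv_eq_fderiv
  refine (congrArg (fun L : EuclideanSpace ℝ (Fin (2 * n + 1)) →L[ℝ] ℝ => L u) h3).trans ?_
  have h4 := ((S.contDiffAt_ηInChart hy).differentiableAt (by simp)).hasFDerivAt.clm_apply
    (hasFDerivAt_const v y)
  rw [h4.fderiv]
  simp

/-- The relation `dη(X, Y) = g(X, φ Y)` in a chart. -/
theorem fderiv_ηInChart_sub [T2Space M] {p : M} {y : EuclideanSpace ℝ (Fin (2 * n + 1))}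
    (hy : y ∈ (extChartAt (𝓡 (2 * n + 1)) p).target)
    (u v : EuclideanSpace ℝ (Fin (2 * n + 1))) :
    fderiv ℝ (S.ηInChart p) y u v - fderiv ℝ (S.ηInChart p) y v u
      = 2 * S.g.inChartForm p y u (S.φInChart p y v) := by
  obtain ⟨X, hX, hXe⟩ := exists_isSmoothVectorField_eq_chartFrame hy u
  obtain ⟨Y, hY, hYe⟩ := exists_isSmoothVectorField_eq_chartFrame hy v
  have hc : ∀ {V : Π x : M, TangentSpace (𝓡 (2 * n + 1)) x} {w}
      (_ : ∀ᶠ z in 𝓝 y, V ((extChartAt (𝓡 (2 * n + 1)) p).symm z) = chartFrame p z w),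
      ∀ᶠ z in 𝓝 y, chartCoframe p z (V ((extChartAt (𝓡 (2 * n + 1)) p).symm z)) = w := by
    intro V w hV
    filter_upwards [hV, (isOpen_extChartAt_target (I := 𝓡 (2 * n + 1)) p).mem_nhds hy] with z h1 h2
    rw [h1, chartCoframe_chartFrame h2]
  have hb := chartCoframe_mlieBracket hy hX hY (v := fun _ => u) (w := fun _ => v) (hc hXe) (hc hYe)
  have hb' : VectorField.mlieBracket (𝓡 (2 * n + 1)) X Y
      ((extChartAt (𝓡 (2 * n + 1)) p).symm y) = 0 := by
    rw [← chartFrame_chartCoframe hy (VectorField.mlieBracket (𝓡 (2 * n + 1)) X Y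
      ((extChartAt (𝓡 (2 * n + 1)) p).symm y)), hb]
    simp only [fderiv_fun_const, Pi.zero_apply, _root_.zero_apply, sub_zero]
    exact (chartFrame p y).map_zero
  have h := S.dη_eq X Y hX hY ((extChartAt (𝓡 (2 * n + 1)) p).symm y)
  rw [extDerivOneForm, hb', map_zero, hXe.self_of_nhds, hYe.self_of_nhds,
    S.mvfderiv_η_apply hy hY hYe, S.mvfderiv_η_apply hy hX hXe] at h
  have h5 : S.g.inChartForm p y u (S.φInChart p y v) = _ := S.g.inChartForm_apply p y _ _
  rw [S.chartFrame_φInChart hy] at h5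
  rw [h5, ← h]
  ring

theorem φ_ξ (x : M) : S.φ x (S.ξ x) = 0 := by
  -- `φ² ξ = 0`, so `φ² (φ ξ) = 0` and `φ ξ` is a multiple of `ξ`; the factor squares to zero
  have h1 : S.φ x (S.φ x (S.ξ x)) = 0 := by rw [S.φ_sq, S.η_ξ, one_smul, sub_self]
  have h2 : S.η x (S.φ x (S.ξ x)) = 0 := by
    have h3 : S.φ x (S.φ x (S.φ x (S.ξ x))) = 0 := by rw [h1, map_zero]
    rw [S.φ_sq, sub_eq_zero] at h3
    have h4 := congrArg (S.φ x) h3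
    rw [h1, map_smul] at h4
    have h5 : S.η x (S.φ x (S.ξ x)) • S.η x (S.φ x (S.ξ x)) • S.ξ x = 0 := by
      rw [← h3]
      exact h4.symm
    have h6 := congrArg (S.η x) h5
    rw [map_smul, map_smul, S.η_ξ, map_zero] at h6
    simpa using h6
  have h7 := S.φ_sq x (S.φ x (S.ξ x))
  rw [h1, map_zero, h2, zero_smul, sub_zero] at h7
  exact h7.symm

/-- The vanishing of the torsion `N(X, ξ)`, in a chart: `φ (L_ξ φ) = 0`. -/
theorem φInChart_lieDerivative [T2Space M] (hS : S.IsParaSasakian) {p : M}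
    {y : EuclideanSpace ℝ (Fin (2 * n + 1))}
    (hy : y ∈ (extChartAt (𝓡 (2 * n + 1)) p).target)
    (u : EuclideanSpace ℝ (Fin (2 * n + 1))) :
    S.φInChart p y (S.φInChart p y (fderiv ℝ (S.ξInChart p) y u)
      - fderiv ℝ (S.ξInChart p) y (S.φInChart p y u)
      + fderiv ℝ (S.φInChart p) y (S.ξInChart p y) u) = 0 := by
  obtain ⟨X, hX, hXe⟩ := exists_isSmoothVectorField_eq_chartFrame hy u
  have htgt := (isOpen_extChartAt_target (I := 𝓡 (2 * n + 1)) p).mem_nhds hy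
  have hX' : ∀ᶠ z in 𝓝 y, chartCoframe p z (X ((extChartAt (𝓡 (2 * n + 1)) p).symm z)) = u := by
    filter_upwards [hXe, htgt] with z h1 h2
    rw [h1, chartCoframe_chartFrame h2]
  have hφX : ∀ᶠ z in 𝓝 y, chartCoframe p z (S.φ ((extChartAt (𝓡 (2 * n + 1)) p).symm z)
      (X ((extChartAt (𝓡 (2 * n + 1)) p).symm z))) = S.φInChart p z u := by
    filter_upwards [hXe] with z h1
    rw [h1, φInChart_apply]
  have hb1 := chartCoframe_mlieBracket hy hX S.contMDiff_ξ (v := fun _ => u)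
    (w := S.ξInChart p) hX' (Filter.Eventually.of_forall fun _ => rfl)
  have hb2 := chartCoframe_mlieBracket hy (S.isSmoothVectorField_φ hX) S.contMDiff_ξ
    (v := fun z => S.φInChart p z u) (w := S.ξInChart p) hφX
    (Filter.Eventually.of_forall fun _ => rfl)
  have hder : fderiv ℝ (fun z => S.φInChart p z u) y (S.ξInChart p y)
      = fderiv ℝ (S.φInChart p) y (S.ξInChart p y) u := by
    have h4 := ((S.contDiffAt_φInChart hy).differentiableAt (by simp)).hasFDerivAt.clm_apply
      (hasFDerivAt_const u y)
    rw [h4.fderiv]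
    simp
  -- since `φ ξ = 0`, two of the four brackets of `N(X, ξ)` vanish
  have hzero : (fun x => S.φ x (S.ξ x)) = (0 : Π x : M, TangentSpace (𝓡 (2 * n + 1)) x) :=
    funext S.φ_ξ
  have h := hS X S.ξ hX S.contMDiff_ξ ((extChartAt (𝓡 (2 * n + 1)) p).symm y)
  rw [nijenhuis, S.dη_eq X S.ξ hX S.contMDiff_ξ, S.φ_ξ, map_zero, mul_zero, zero_smul, sub_zero,
    hzero, VectorField.mlieBracket_zero_right, VectorField.mlieBracket_zero_right] at h
  simp only [Pi.zero_apply, map_zero, add_zero, sub_zero] at h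
  rw [← map_sub, ← chartFrame_chartCoframe hy (VectorField.mlieBracket (𝓡 (2 * n + 1)) X S.ξ
    ((extChartAt (𝓡 (2 * n + 1)) p).symm y)), ← chartFrame_chartCoframe hy
    (VectorField.mlieBracket (𝓡 (2 * n + 1)) (fun y => S.φ y (X y)) S.ξ
    ((extChartAt (𝓡 (2 * n + 1)) p).symm y)), hb1, hb2, ← S.chartFrame_φInChart hy, ← map_sub,
    ← S.chartFrame_φInChart hy] at h
  have h' := congrArg (chartCoframe p y) h
  rw [chartCoframe_chartFrame hy, map_zero, hder] at h'
  rw [← h']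
  congr 1
  simp
  abel

/-- The Reeb vector field of a para-Sasakian structure is a Killing field, in a chart. -/
theorem killing_ξInChart [T2Space M] (hS : S.IsParaSasakian) {p : M}
    {y : EuclideanSpace ℝ (Fin (2 * n + 1))}
    (hy : y ∈ (extChartAt (𝓡 (2 * n + 1)) p).target)
    (u w : EuclideanSpace ℝ (Fin (2 * n + 1))) :
    fderiv ℝ (S.g.inChartForm p) y (S.ξInChart p y) u w
      + S.g.inChartForm p y (fderiv ℝ (S.ξInChart p) y u) w
      + S.g.inChartForm p y u (fderiv ℝ (S.ξInChart p) y w) = 0 := by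
  have htgt := (isOpen_extChartAt_target (I := 𝓡 (2 * n + 1)) p).mem_nhds hy
  refine killing_of_paraSasakian (η := S.ηInChart p) (φ := S.φInChart p) ?_
    ((S.contDiffAt_ξInChart hy).differentiableAt (by simp))
    ((S.contDiffAt_φInChart hy).differentiableAt (by simp))
    ((S.g.contDiffAt_inChartForm hy).differentiableAt (by simp))
    ?_ ?_ ?_ ?_ (fun u => S.φInChart_lieDerivative hS hy u) u w
  · exact (S.contDiffAt_ηInChart hy).of_le two_le_infty
  · filter_upwards [htgt] with z hz using S.fderiv_ηInChart_sub hz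
  · filter_upwards [htgt] with z hz using S.ηInChart_ξInChart hz
  · filter_upwards [htgt] with z hz using S.φInChart_φInChart hz
  · filter_upwards [htgt] with z hz using S.inChartForm_φInChart hz

/-- The Reeb field is the `g`-gradient of the contact form: `g(v, ξ) = η v`. -/
theorem inChartForm_ξInChart {p : M} {y : EuclideanSpace ℝ (Fin (2 * n + 1))}
    (hy : y ∈ (extChartAt (𝓡 (2 * n + 1)) p).target) (v : EuclideanSpace ℝ (Fin (2 * n + 1))) :
    S.g.inChartForm p y v (S.ξInChart p y) = S.ηInChart p y v := by
  have h := S.g_φ _ (chartFrame p y v) (chartFrame p y (S.ξInChart p y))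
  rw [S.chartFrame_ξInChart hy, S.φ_ξ, map_zero, S.η_ξ, mul_one] at h
  rw [SemiRiemannianMetric.inChartForm_apply, S.chartFrame_ξInChart hy, ηInChart_apply]
  linarith

end ParaContactMetricStructure

/-! ### Geodesics orthogonal to the Reeb field and their symmetries -/

namespace ParaContactMetricStructure

variable {n : ℕ} {M : Type*} [TopologicalSpace M]
  [ChartedSpace (EuclideanSpace ℝ (Fin (2 * n + 1))) M] [IsManifold (𝓡 (2 * n + 1)) ∞ M]
  (S : ParaContactMetricStructure n M)

/-- The value of `η` on a tangent vector depends only on its coordinates. -/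
theorem η_congr {x x' : M} (h : x = x') (a : EuclideanSpace ℝ (Fin (2 * n + 1))) :
    S.η x a = S.η x' a := by
  subst h
  rfl

/-- The value of `η` on the velocity of a curve, computed in a chart. -/
theorem η_mfderiv_curve {γ : ℝ → M} {t : ℝ} {p : M}
    (hγ : MDifferentiableAt 𝓘(ℝ, ℝ) (𝓡 (2 * n + 1)) γ t)
    (hp : γ t ∈ (chartAt (EuclideanSpace ℝ (Fin (2 * n + 1))) p).source) :
    S.η (γ t) (mfderiv 𝓘(ℝ, ℝ) (𝓡 (2 * n + 1)) γ t (1 : ℝ))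
      = S.ηInChart p (extChartAt (𝓡 (2 * n + 1)) p (γ t))
        (deriv (fun s => extChartAt (𝓡 (2 * n + 1)) p (γ s)) t) := by
  have hev : (fun s => (extChartAt (𝓡 (2 * n + 1)) p).symm (extChartAt (𝓡 (2 * n + 1)) p (γ s)))
      =ᶠ[𝓝 t] γ := by
    filter_upwards [hγ.continuousAt.preimage_mem_nhds ((chartAt _ p).open_source.mem_nhds hp)]
      with s hs
    exact (extChartAt (𝓡 (2 * n + 1)) p).left_inv (by rwa [extChartAt_source])
  have hψ : MDifferentiableAt 𝓘(ℝ, ℝ) 𝓘(ℝ, EuclideanSpace ℝ (Fin (2 * n + 1)))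
      (fun s => extChartAt (𝓡 (2 * n + 1)) p (γ s)) t :=
    ((contMDiffAt_extChartAt' (n := ∞) hp).mdifferentiableAt (by simp)).comp t hγ
  have h1 := mfderiv_comp_apply t
    ((contMDiffAt_chart_symm (mem_target_of_mem_source hp)).mdifferentiableAt
      (by simp)) hψ (1 : ℝ)
  have h2 : (mfderiv 𝓘(ℝ, ℝ) (𝓡 (2 * n + 1)) (fun s => (extChartAt (𝓡 (2 * n + 1)) p).symm
      (extChartAt (𝓡 (2 * n + 1)) p (γ s))) t : ℝ →L[ℝ] EuclideanSpace ℝ (Fin (2 * n + 1)))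
      = mfderiv 𝓘(ℝ, ℝ) (𝓡 (2 * n + 1)) γ t := hev.mfderiv_eq
  have h3 : (mfderiv 𝓘(ℝ, ℝ) 𝓘(ℝ, EuclideanSpace ℝ (Fin (2 * n + 1)))
      (fun s => extChartAt (𝓡 (2 * n + 1)) p (γ s)) t : ℝ →L[ℝ] EuclideanSpace ℝ (Fin (2 * n + 1)))
      (1 : ℝ) = deriv (fun s => extChartAt (𝓡 (2 * n + 1)) p (γ s)) t := by
    rw [mfderiv_eq_fderiv]
    exact fderiv_apply_one_eq_deriv
  have h4 : (mfderiv 𝓘(ℝ, ℝ) (𝓡 (2 * n + 1)) γ t (1 : ℝ) : EuclideanSpace ℝ (Fin (2 * n + 1)))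
      = chartFrame p (extChartAt (𝓡 (2 * n + 1)) p (γ t))
        (deriv (fun s => extChartAt (𝓡 (2 * n + 1)) p (γ s)) t) :=
    (congrArg (fun L : ℝ →L[ℝ] EuclideanSpace ℝ (Fin (2 * n + 1)) => L (1 : ℝ)) h2).symm.trans
      (h1.trans (congrArg (chartFrame p (extChartAt (𝓡 (2 * n + 1)) p (γ t))) h3))
  refine (S.η_congr (hev.eq_of_nhds).symm _).trans ?_
  rw [ηInChart_apply]
  exact congrArg (S.η _) h4

/-- Along a geodesic of a para-Sasakian manifold the function `η(γ')` is constant. -/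
theorem hasDerivAt_ηInChart_geodesic [T2Space M] (hS : S.IsParaSasakian) {γ : ℝ → M} {J : Set ℝ}
    (hJ : IsOpen J) (hγ : S.g.IsGeodesicOn γ J) {t : ℝ} (ht : t ∈ J) {p : M}
    (hp : γ t ∈ (chartAt (EuclideanSpace ℝ (Fin (2 * n + 1))) p).source) :
    HasDerivAt (fun s => S.ηInChart p (extChartAt (𝓡 (2 * n + 1)) p (γ s))
      (deriv (fun s => extChartAt (𝓡 (2 * n + 1)) p (γ s)) s)) 0 t := by
  have hy := mem_target_of_mem_source hp
  obtain ⟨h1, h2⟩ := S.g.isGeodesicOn_iff_geodesicEq.1 hγ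
  obtain ⟨k1, k2⟩ := hasDerivAt_deriv_of_contDiffAt
    (SemiRiemannianMetric.contDiffAt_chart_comp (h1.contMDiffAt (hJ.mem_nhds ht)) hp)
  refine (hasDerivAt_inner_killing (g := S.g.inChartForm p) (ξ := S.ξInChart p)
    ((S.g.contDiffAt_inChartForm hy).differentiableAt (by simp))
    ((S.contDiffAt_ξInChart hy).differentiableAt (by simp)) k1 k2
    (S.g.inChartForm_symm p _) (h2 t ht p hp _)
    (S.killing_ξInChart hS hy)).congr_of_eventuallyEq ?_
  filter_upwards [SemiRiemannianMetric.eventually_mem_source hJ h1.continuousOn ht hp] with s hs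
  exact (S.inChartForm_ξInChart (mem_target_of_mem_source hs.2) _).symm

/-- A geodesic that starts orthogonally to the Reeb field is a `φ`-geodesic. -/
theorem isPhiGeodesicOn_of_horizontal [T2Space M] (hS : S.IsParaSasakian) {γ : ℝ → M} {a : ℝ}
    (ha : 0 < a) (hγ : S.g.IsGeodesicOn γ (Ioo (-a) a)) {p : M}
    (hp : ∀ t ∈ Ioo (-a) a, γ t ∈ (chartAt (EuclideanSpace ℝ (Fin (2 * n + 1))) p).source)
    (h0 : S.ηInChart p (extChartAt (𝓡 (2 * n + 1)) p (γ 0))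
      (deriv (fun s => extChartAt (𝓡 (2 * n + 1)) p (γ s)) 0) = 0) :
    S.IsPhiGeodesicOn γ (Ioo (-a) a) := by
  refine ⟨hγ, fun t ht => ?_⟩
  have hd := fun t ht => S.hasDerivAt_ηInChart_geodesic hS isOpen_Ioo hγ (t := t) ht (hp t ht)
  rw [S.η_mfderiv_curve ((hγ.1.contMDiffAt (isOpen_Ioo.mem_nhds ht)).mdifferentiableAt (by simp))
    (hp t ht), ← h0]
  exact isOpen_Ioo.is_const_of_deriv_eq_zero isPreconnected_Ioo
    (fun s hs => (hd s hs).differentiableAt.differentiableWithinAt)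
    (fun s hs => (hd s hs).deriv) ht ⟨by linarith, ha⟩

theorem IsPhiGeodesicOn.comp_const_add {γ : ℝ → M} {J J' : Set ℝ} (hJo : IsOpen J)
    (h : S.IsPhiGeodesicOn γ J) (b : ℝ) (hJ : ∀ s ∈ J', b + s ∈ J) :
    S.IsPhiGeodesicOn (fun s => γ (b + s)) J' := by
  have h1 := h.1.comp_affine S.g (J' := J') b 1 (by simpa using hJ)
  simp only [one_mul] at h1
  refine ⟨h1, fun t ht => ?_⟩
  have hd := (h.1.1.contMDiffAt (hJo.mem_nhds (hJ t ht))).mdifferentiableAt (by simp)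
  have hadd : MDifferentiableAt 𝓘(ℝ, ℝ) 𝓘(ℝ, ℝ) (fun s : ℝ => b + s) t :=
    (differentiableAt_id.const_add b).mdifferentiableAt
  refine (S.η_mfderiv_curve (γ := fun s => γ (b + s)) (p := γ (b + t)) (hd.comp t hadd)
    (mem_chart_source _ _)).trans ?_
  rw [deriv_comp_const_add (fun s => extChartAt (𝓡 (2 * n + 1)) (γ (b + t)) (γ s)),
    ← S.η_mfderiv_curve hd (mem_chart_source _ _)]
  exact h.2 _ (hJ t ht)

/-- The symmetry at the midpoint of a `φ`-geodesic segment exchanges its endpoints. -/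
theorem exists_mem_phiSymmetries_of_isPhiGeodesicOn [T2Space M] (hS : S.IsPhiSymmetric)
    {γ : ℝ → M} {a t : ℝ} (ht : t ∈ Ioo 0 a) (hγ : S.IsPhiGeodesicOn γ (Ioo (-a) a)) :
    ∃ F ∈ S.phiSymmetries, (F : M ≃ₜ M) (γ 0) = γ t := by
  obtain ⟨σ, hσ⟩ := hS.exists_symmetry (γ (t / 2))
  obtain ⟨F, hF⟩ := hS.extendable _ σ hσ
  refine ⟨⟨F, hF.1.1⟩, ⟨_, σ, hσ, hF⟩, ?_⟩
  change F (γ 0) = γ t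
  obtain ⟨ht0, hta⟩ := ht
  have hb : 0 < a - t / 2 := by linarith
  have hc : S.IsPhiGeodesicOn (fun s => γ (t / 2 + s)) (Ioo (-(a - t / 2)) (a - t / 2)) :=
    IsPhiGeodesicOn.comp_const_add S isOpen_Ioo hγ _ fun s hs =>
      ⟨by linarith [hs.1], by linarith [hs.2]⟩
  have hreeb : γ (t / 2 + 0) ∈ S.reebTrajectory (γ (t / 2)) := by
    obtain ⟨c, hc0, hc⟩ := hS.complete (γ (t / 2))
    exact ⟨c, univ, 0, isOpen_univ, ordConnected_univ, mem_univ _, mem_univ _,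
      hc.isMIntegralCurveOn _, hc0, by rw [hc0, add_zero]⟩
  have hsym := hσ.2.2.2 _ _ hb hc hreeb
  have h0 : (0 : ℝ) ∈ Ioo (-(a - t / 2)) (a - t / 2) := ⟨by linarith, hb⟩
  have hcont : ContinuousAt (fun s => γ (t / 2 + s)) 0 :=
    hc.1.1.continuousOn.continuousAt (isOpen_Ioo.mem_nhds h0)
  have hcont' : Filter.Tendsto (fun s => γ (t / 2 + s)) (𝓝 0) (𝓝 (γ (t / 2))) := by
    have := hcont.tendsto
    rwa [add_zero] at this
  -- near the midpoint `F` is the symmetry, and it reverses the geodesic; both sides are geodesics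
  have hloc : (fun s => F (γ (t / 2 + s))) =ᶠ[𝓝 0] fun s => γ (t / 2 + (0 + -1 * s)) := by
    filter_upwards [hcont'.eventually hF.2, isOpen_Ioo.mem_nhds h0,
      hcont'.eventually (σ.open_source.mem_nhds hσ.1)] with s hs1 hs2 hs3
    rw [hs1, hsym s hs2 hs3]
    ring_nf
  have heq := (hc.1.comp_isometry S.g hF.1.1 isOpen_Ioo).eqOn S.g isOpen_Ioo isPreconnected_Ioo
    (hc.1.comp_affine S.g (J' := Ioo (-(a - t / 2)) (a - t / 2)) 0 (-1)
      fun s hs => ⟨by linarith [hs.2], by linarith [hs.1]⟩) h0 hloc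
  have := heq (x := -(t / 2)) ⟨by linarith, by linarith⟩
  simp only at this
  convert this using 2 <;> ring_nf

end ParaContactMetricStructure

/-! ### The Reeb flow and the group generated by the symmetries -/

namespace ParaContactMetricStructure

variable {n : ℕ} {M : Type*} [TopologicalSpace M]
  [ChartedSpace (EuclideanSpace ℝ (Fin (2 * n + 1))) M] [IsManifold (𝓡 (2 * n + 1)) ∞ M]
  (S : ParaContactMetricStructure n M)

/-- The points `p` and `q` are related if some element of the group generated by the `φ`-geodesic
symmetries sends `p` to `q`. -/
def Related (p q : M) : Prop :=
  ∃ F ∈ Subgroup.closure S.phiSymmetries, (F : M ≃ₜ M) p = q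

variable {S} in
theorem Related.refl (p : M) : S.Related p p := ⟨1, Subgroup.one_mem _, rfl⟩

variable {S} in
theorem Related.symm {p q : M} (h : S.Related p q) : S.Related q p := by
  obtain ⟨F, hF, rfl⟩ := h
  exact ⟨F⁻¹, Subgroup.inv_mem _ hF, (F : M ≃ₜ M).symm_apply_apply p⟩

variable {S} in
theorem Related.trans {p q r : M} (h : S.Related p q) (h' : S.Related q r) : S.Related p r := by
  obtain ⟨F, hF, rfl⟩ := h
  obtain ⟨F', hF', rfl⟩ := h'
  exact ⟨F' * F, Subgroup.mul_mem _ hF' hF, rfl⟩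

/-- The image of an integral curve of `ξ` under an automorphism is an integral curve of `ξ`. -/
theorem IsAutomorphism.isMIntegralCurve {F : M ≃ₜ M} (hF : S.IsAutomorphism F) {c : ℝ → M}
    (hc : IsMIntegralCurve c S.ξ) : IsMIntegralCurve (fun t => F (c t)) S.ξ := by
  intro t
  have h := (((hF.1.1 (c t)).mdifferentiableAt (by simp)).hasMFDerivAt.comp t (hc t))
  refine h.congr_mfderiv ?_
  have h1 := hF.2.2.1 (c t)
  refine ContinuousLinearMap.ext fun (s : ℝ) => ?_
  change mfderiv (𝓡 (2 * n + 1)) (𝓡 (2 * n + 1)) F (c t) (s • S.ξ (c t))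
    = s • S.ξ (F (c t))
  rw [map_smul, h1]

theorem contMDiff_ξ_one : ContMDiff (𝓡 (2 * n + 1)) (𝓡 (2 * n + 1)).tangent 1
    (fun x => (⟨x, S.ξ x⟩ : TangentBundle (𝓡 (2 * n + 1)) M)) :=
  ContMDiff.of_le S.contMDiff_ξ (one_le_two.trans two_le_infty)

variable {S}

/-- The flow of the complete vector field `ξ`. -/
noncomputable def reebFlow (hS : S.IsPhiSymmetric) (t : ℝ) (x : M) : M :=
  (hS.complete x).choose t

variable (hS : S.IsPhiSymmetric)

theorem reebFlow_zero (x : M) : reebFlow hS 0 x = x := (hS.complete x).choose_spec.1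

theorem isMIntegralCurve_reebFlow (x : M) :
    IsMIntegralCurve (fun t => reebFlow hS t x) S.ξ := (hS.complete x).choose_spec.2

theorem eq_reebFlow [T2Space M] {c : ℝ → M} (hc : IsMIntegralCurve c S.ξ) (t : ℝ) :
    c t = reebFlow hS t (c 0) :=
  congrFun (isMIntegralCurve_Ioo_eq_of_contMDiff_boundaryless (t₀ := 0) S.contMDiff_ξ_one hc
    (isMIntegralCurve_reebFlow hS (c 0)) (reebFlow_zero hS _).symm) t

theorem reebFlow_add [T2Space M] (s t : ℝ) (x : M) :
    reebFlow hS (s + t) x = reebFlow hS s (reebFlow hS t x) := by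
  have h := eq_reebFlow hS ((isMIntegralCurve_reebFlow hS x).comp_add t) s
  simpa using h

theorem reebFlow_eq_of_isMIntegralCurveOn [T2Space M] {c : ℝ → M} {ε : ℝ}
    (hc : IsMIntegralCurveOn c S.ξ (Ioo (-ε) ε)) {t : ℝ} (ht : t ∈ Ioo (-ε) ε) :
    c t = reebFlow hS t (c 0) :=
  isMIntegralCurveOn_Ioo_eqOn_of_contMDiff_boundaryless (t₀ := 0)
    ⟨by linarith [ht.1, ht.2], by linarith [ht.1, ht.2]⟩ S.contMDiff_ξ_one hc
    ((isMIntegralCurve_reebFlow hS (c 0)).isMIntegralCurveOn _) (reebFlow_zero hS _).symm ht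

/-- The group generated by the symmetries commutes with the Reeb flow. -/
theorem apply_reebFlow [T2Space M] {F : S.g.isometryGroup}
    (hF : F ∈ Subgroup.closure S.phiSymmetries) (t : ℝ) (x : M) :
    (F : M ≃ₜ M) (reebFlow hS t x) = reebFlow hS t ((F : M ≃ₜ M) x) := by
  induction hF using Subgroup.closure_induction generalizing x with
  | mem F hF =>
    obtain ⟨y, σ, -, hF⟩ := hF
    have h := eq_reebFlow hS (hF.1.isMIntegralCurve S (isMIntegralCurve_reebFlow hS x)) t
    rwa [reebFlow_zero] at h
  | one => rfl
  | mul F F' _ _ h h' => exact (congrArg (F : M ≃ₜ M) (h' x)).trans (h _)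
  | inv F _ h =>
    have h1 := h ((F : M ≃ₜ M).symm x)
    rw [Homeomorph.apply_symm_apply] at h1
    exact (Homeomorph.symm_apply_eq _).2 h1.symm

theorem Related.reebFlow [T2Space M] {p q : M} (h : S.Related p q) (t : ℝ) :
    S.Related (reebFlow hS t p) (reebFlow hS t q) := by
  obtain ⟨F, hF, rfl⟩ := h
  exact ⟨F, hF, apply_reebFlow hS hF t p⟩

/-- The times at which the Reeb flow sends `p` to a related point form a group, because the group
generated by the symmetries commutes with the Reeb flow. -/
noncomputable def periods [T2Space M] (p : M) : AddSubgroup ℝ where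
  carrier := {τ | S.Related p (reebFlow hS τ p)}
  zero_mem' := by
    rw [Set.mem_ofPred_eq, reebFlow_zero]
    exact Related.refl p
  add_mem' := by
    intro a b ha hb
    rw [Set.mem_ofPred_eq, reebFlow_add]
    exact ha.trans (hb.reebFlow hS a)
  neg_mem' := by
    intro a ha
    have h := Related.reebFlow hS ha (-a)
    rw [← reebFlow_add, neg_add_cancel, reebFlow_zero] at h
    exact h.symm

end ParaContactMetricStructure

/-- An additive subgroup of `ℝ` that contains a nondegenerate interval `[0, a]` is everything. -/
theorem addSubgroup_eq_top_of_Icc_subset {T : AddSubgroup ℝ} {a : ℝ} (ha : 0 < a)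
    (h : Icc 0 a ⊆ (T : Set ℝ)) : T = ⊤ := by
  refine eq_top_iff.2 fun τ _ => ?_
  have hpos : ∀ τ : ℝ, 0 ≤ τ → τ ∈ T := by
    intro τ hτ
    obtain ⟨N, hN⟩ := exists_nat_gt (τ / a)
    have hN0 : (0 : ℝ) < N := lt_of_le_of_lt (by positivity) hN
    have h1 : τ / N ∈ T := h ⟨by positivity, by
      rw [div_le_iff₀ hN0]
      rw [div_lt_iff₀ ha] at hN
      linarith⟩
    have h2 := T.nsmul_mem h1 N
    rwa [nsmul_eq_mul, mul_div_cancel₀ _ hN0.ne'] at h2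
  rcases le_total 0 τ with h0 | h0
  · exact hpos τ h0
  · simpa using T.neg_mem (hpos (-τ) (by linarith))

/-! ### Coordinates adapted to the Reeb flow -/

namespace ParaContactMetricStructure

variable {n : ℕ} {M : Type*} [TopologicalSpace M]
  [ChartedSpace (EuclideanSpace ℝ (Fin (2 * n + 1))) M] [IsManifold (𝓡 (2 * n + 1)) ∞ M]
  {S : ParaContactMetricStructure n M} (hS : S.IsPhiSymmetric)

/-- A solution, in a chart, of the differential equation of `ξ` is an integral curve of `ξ`. -/
theorem isMIntegralCurveOn_chart_symm {c : ℝ → EuclideanSpace ℝ (Fin (2 * n + 1))} {J : Set ℝ}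
    {p : M} (hc : ∀ t ∈ J, HasDerivAt c (S.ξInChart p (c t)) t ∧
      c t ∈ (extChartAt (𝓡 (2 * n + 1)) p).target) :
    IsMIntegralCurveOn (fun t => (extChartAt (𝓡 (2 * n + 1)) p).symm (c t)) S.ξ J := by
  intro t ht
  obtain ⟨h1, h2⟩ := hc t ht
  have h := ((contMDiffAt_chart_symm h2).mdifferentiableAt (by simp)).hasMFDerivAt.comp t
    h1.hasFDerivAt.hasMFDerivAt
  refine (h.congr_mfderiv ?_).hasMFDerivWithinAt
  refine ContinuousLinearMap.ext fun (s : ℝ) => ?_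
  change chartFrame p (c t) (s • S.ξInChart p (c t)) = s • S.ξ _
  rw [map_smul, S.chartFrame_ξInChart h2]

/-- In the chart at `p`, the Reeb flow is strictly differentiable at `(p, 0)`, jointly in the point
and the time. -/
theorem exists_chart_reebFlow [T2Space M] (p : M) :
    ∃ α : EuclideanSpace ℝ (Fin (2 * n + 1)) → ℝ → EuclideanSpace ℝ (Fin (2 * n + 1)),
      (∀ᶠ q : EuclideanSpace ℝ (Fin (2 * n + 1)) × ℝ in 𝓝 (extChartAt (𝓡 (2 * n + 1)) p p, 0),
        α q.1 q.2 ∈ (extChartAt (𝓡 (2 * n + 1)) p).target ∧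
        (extChartAt (𝓡 (2 * n + 1)) p).symm (α q.1 q.2)
          = reebFlow hS q.2 ((extChartAt (𝓡 (2 * n + 1)) p).symm q.1)) ∧
      α (extChartAt (𝓡 (2 * n + 1)) p p) 0 = extChartAt (𝓡 (2 * n + 1)) p p ∧
      HasStrictFDerivAt (fun q : EuclideanSpace ℝ (Fin (2 * n + 1)) × ℝ => α q.1 q.2)
        (ContinuousLinearMap.fst ℝ _ _ + (ContinuousLinearMap.snd ℝ _ _).smulRight
          (S.ξInChart p (extChartAt (𝓡 (2 * n + 1)) p p)))
        (extChartAt (𝓡 (2 * n + 1)) p p, 0) := by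
  have hp : extChartAt (𝓡 (2 * n + 1)) p p ∈ (extChartAt (𝓡 (2 * n + 1)) p).target :=
    mem_extChartAt_target p
  obtain ⟨ε, hε, r, hr, α, hα, hstrict⟩ := exists_flow_hasStrictFDerivAt
    ((S.contDiffAt_ξInChart hp).of_le (one_le_two.trans two_le_infty))
    ((isOpen_extChartAt_target (I := 𝓡 (2 * n + 1)) p).mem_nhds hp)
  refine ⟨α, ?_, (hα _ (mem_ball_self hr)).1, hstrict⟩
  filter_upwards [prod_mem_nhds (ball_mem_nhds (extChartAt (𝓡 (2 * n + 1)) p p) hr)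
    (isOpen_Ioo.mem_nhds (⟨by linarith, hε⟩ : (0 : ℝ) ∈ Ioo (-ε) ε))]
  rintro ⟨x, t⟩ ⟨hx, ht⟩
  refine ⟨((hα x hx).2 t ht).2, ?_⟩
  have h := reebFlow_eq_of_isMIntegralCurveOn hS (isMIntegralCurveOn_chart_symm (hα x hx).2) ht
  rwa [(hα x hx).1] at h

/-- The contact form at the centre `p` of the chart `ψ`: `η_p = ψ^* (η in the chart)`, since `dψ` is
inverse to the coordinate frame. -/
theorem ηInChart_mfderiv_extChartAt (p : M) (v : TangentSpace (𝓡 (2 * n + 1)) p) :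
    S.ηInChart p (extChartAt (𝓡 (2 * n + 1)) p p)
      (mfderiv (𝓡 (2 * n + 1)) 𝓘(ℝ, EuclideanSpace ℝ (Fin (2 * n + 1)))
        (extChartAt (𝓡 (2 * n + 1)) p) p v) = S.η p v := by
  have h1 := mfderiv_comp_apply p ((contMDiffAt_chart_symm
    (mem_extChartAt_target (I := 𝓡 (2 * n + 1)) p)).mdifferentiableAt (by simp))
    ((contMDiffAt_extChartAt (I := 𝓡 (2 * n + 1)) (n := 1) (x := p)).mdifferentiableAt (by simp)) v
  have hev : (extChartAt (𝓡 (2 * n + 1)) p).symm ∘ (extChartAt (𝓡 (2 * n + 1)) p) =ᶠ[𝓝 p] id := by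
    filter_upwards [extChartAt_source_mem_nhds (I := 𝓡 (2 * n + 1)) p] with y hy
    exact (extChartAt (𝓡 (2 * n + 1)) p).left_inv hy
  have h2 : (mfderiv (𝓡 (2 * n + 1)) (𝓡 (2 * n + 1)) ((extChartAt (𝓡 (2 * n + 1)) p).symm ∘
      (extChartAt (𝓡 (2 * n + 1)) p)) p : EuclideanSpace ℝ (Fin (2 * n + 1)) →L[ℝ] _) v
      = (v : EuclideanSpace ℝ (Fin (2 * n + 1))) := by
    have h3 := hev.mfderiv_eq (I := 𝓡 (2 * n + 1)) (I' := 𝓡 (2 * n + 1))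
    rw [mfderiv_id] at h3
    exact congrArg (fun L : EuclideanSpace ℝ (Fin (2 * n + 1)) →L[ℝ]
      EuclideanSpace ℝ (Fin (2 * n + 1)) => L v) h3
  have h4 := S.η_congr (extChartAt_to_inv (I := 𝓡 (2 * n + 1)) p) v
  refine Eq.trans ?_ h4
  exact congrArg (S.η ((extChartAt (𝓡 (2 * n + 1)) p).symm (extChartAt (𝓡 (2 * n + 1)) p p)))
    (h1.symm.trans h2)

/-- Coordinates adapted to the `φ`-geodesics through `p` and to the Reeb flow: the point with
coordinates `v` is obtained from the end point of a `φ`-geodesic that starts at `p` by following the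
Reeb flow during the time `ℓ v`. The differential of `ℓ ∘ Φ` at `p` is the contact form. -/
theorem exists_adapted_coordinates [T2Space M] (p : M) :
    ∃ (Φ : OpenPartialHomeomorph M (EuclideanSpace ℝ (Fin (2 * n + 1))))
      (ℓ : EuclideanSpace ℝ (Fin (2 * n + 1)) →L[ℝ] ℝ) (z : EuclideanSpace ℝ (Fin (2 * n + 1))),
      ℓ z = 1 ∧ p ∈ Φ.source ∧ Φ p = 0 ∧
      HasMFDerivAt (𝓡 (2 * n + 1)) 𝓘(ℝ, ℝ) (fun y => ℓ (Φ y)) p (S.η p) ∧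
      (∀ v ∈ Φ.target, S.Related p (reebFlow hS (-ℓ v) (Φ.symm v))) ∧
      ∀ v ∈ Φ.target, ∀ t : ℝ, v + t • z ∈ Φ.target →
        Φ.symm (v + t • z) = reebFlow hS t (Φ.symm v) := by
  have hp : extChartAt (𝓡 (2 * n + 1)) p p ∈ (extChartAt (𝓡 (2 * n + 1)) p).target :=
    mem_extChartAt_target p
  obtain ⟨a, ha, t₁, ht₁, r, hr, γ, hγ, hγ0, hγs⟩ := S.g.exists_geodesics p
  obtain ⟨α, hα, hα0, hαs⟩ := exists_chart_reebFlow hS p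
  set x₀ := extChartAt (𝓡 (2 * n + 1)) p p with hx₀
  set ℓ := S.ηInChart p x₀ with hℓ
  set z := S.ξInChart p x₀ with hz
  have hℓz : ℓ z = 1 := S.ηInChart_ξInChart hp
  -- the projection to the horizontal space, rescaled to an initial velocity
  let P : EuclideanSpace ℝ (Fin (2 * n + 1)) →L[ℝ] EuclideanSpace ℝ (Fin (2 * n + 1)) :=
    t₁⁻¹ • (ContinuousLinearMap.id ℝ _ - ℓ.smulRight z)
  have hP : ∀ v, P v = t₁⁻¹ • (v - ℓ v • z) := fun v => rfl
  have hPadd : ∀ v (t : ℝ), P (v + t • z) = P v := by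
    intro v t
    rw [hP, hP, map_add, map_smul, hℓz, smul_eq_mul, mul_one, add_smul]
    congr 1
    abel
  have hℓP : ∀ v, ℓ (P v) = 0 := by
    intro v
    rw [hP, map_smul, map_sub, map_smul, hℓz, smul_eq_mul, smul_eq_mul, mul_one, sub_self, mul_zero]
  let e : EuclideanSpace ℝ (Fin (2 * n + 1)) → EuclideanSpace ℝ (Fin (2 * n + 1)) := fun v =>
    extChartAt (𝓡 (2 * n + 1)) p (γ (P v) t₁)
  let G : EuclideanSpace ℝ (Fin (2 * n + 1)) → EuclideanSpace ℝ (Fin (2 * n + 1)) := fun v =>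
    α (e v) (ℓ v)
  have he0 : e 0 = x₀ := by
    simp only [e, map_zero, hγ0, hx₀]
  have hes : HasStrictFDerivAt e ((t₁ • ContinuousLinearMap.id ℝ _) ∘L P) 0 := by
    refine HasStrictFDerivAt.comp (g := fun v => extChartAt (𝓡 (2 * n + 1)) p (γ v t₁)) 0 ?_
      P.hasStrictFDerivAt
    rwa [map_zero]
  have hpair : HasStrictFDerivAt (fun v => (e v, ℓ v))
      (((t₁ • ContinuousLinearMap.id ℝ _) ∘L P).prod ℓ) 0 := hes.prodMk ℓ.hasStrictFDerivAt
  have hGs : HasStrictFDerivAt G ((ContinuousLinearEquiv.refl ℝ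
      (EuclideanSpace ℝ (Fin (2 * n + 1))) : EuclideanSpace ℝ (Fin (2 * n + 1)) →L[ℝ]
      EuclideanSpace ℝ (Fin (2 * n + 1)))) 0 := by
    have h := HasStrictFDerivAt.comp (g := fun q : EuclideanSpace ℝ (Fin (2 * n + 1)) × ℝ =>
      α q.1 q.2) (f := fun v => (e v, ℓ v)) 0 (by rw [he0, map_zero]; exact hαs) hpair
    refine h.congr_fderiv (ContinuousLinearMap.ext fun v => ?_)
    simp [hP, smul_smul, mul_inv_cancel₀ ht₁.1.ne']
  have hG0 : G 0 = x₀ := by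
    simp only [G, he0, map_zero, hα0]
  -- the vectors whose geodesic and Reeb trajectory are controlled
  let W : Set (EuclideanSpace ℝ (Fin (2 * n + 1))) := interior
    {v | P v ∈ ball 0 r ∧ α (e v) (ℓ v) ∈ (extChartAt (𝓡 (2 * n + 1)) p).target ∧
      (extChartAt (𝓡 (2 * n + 1)) p).symm (α (e v) (ℓ v))
          = reebFlow hS (ℓ v) ((extChartAt (𝓡 (2 * n + 1)) p).symm (e v))}
  have hW0 : (0 : EuclideanSpace ℝ (Fin (2 * n + 1))) ∈ W := by
    refine mem_interior_iff_mem_nhds.2 (Filter.Eventually.and ?_ ?_)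
    · have hc := P.continuous.tendsto 0
      rw [map_zero] at hc
      exact hc.eventually (ball_mem_nhds _ hr)
    · have hc : Filter.Tendsto (fun v => (e v, ℓ v)) (𝓝 0) (𝓝 (x₀, 0)) := by
        have := hpair.continuousAt.tendsto
        rwa [he0, map_zero] at this
      exact hc.eventually hα
  have hWspec : ∀ v ∈ W, G v ∈ (extChartAt (𝓡 (2 * n + 1)) p).target ∧ P v ∈ ball 0 r ∧
      (extChartAt (𝓡 (2 * n + 1)) p).symm (G v) = reebFlow hS (ℓ v) (γ (P v) t₁) := by
    intro v hv
    obtain ⟨h1, h2, h3⟩ := interior_subset hv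
    refine ⟨h2, h1, h3.trans ?_⟩
    rw [(extChartAt (𝓡 (2 * n + 1)) p).left_inv]
    rw [extChartAt_source]
    exact (hγ _ h1).2.2.1 t₁ ⟨by linarith [ht₁.1], ht₁.2⟩
  let K := (hGs.toOpenPartialHomeomorph G).restrOpen W isOpen_interior
  have hK : ∀ v, K v = G v := fun v => rfl
  have hK0 : (0 : EuclideanSpace ℝ (Fin (2 * n + 1))) ∈ K.source :=
    ⟨hGs.mem_toOpenPartialHomeomorph_source, hW0⟩
  have hKs : HasFDerivAt K.symm (ContinuousLinearMap.id ℝ (EuclideanSpace ℝ (Fin (2 * n + 1))))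
      x₀ := by
    have := hGs.to_localInverse.hasFDerivAt
    rw [hG0] at this
    exact this
  have hKx : K.symm x₀ = 0 := by
    rw [← hG0, ← hK, K.left_inv hK0]
  let Φ := (chartAt (EuclideanSpace ℝ (Fin (2 * n + 1))) p).trans K.symm
  have hΦsymm : ∀ v, Φ.symm v = (extChartAt (𝓡 (2 * n + 1)) p).symm (G v) := fun v => rfl
  have hΦt : ∀ v ∈ Φ.target, v ∈ W := fun v hv => by
    have : v ∈ K.source := hv.1
    exact this.2
  refine ⟨Φ, ℓ, z, hℓz, ?_, hKx, ?_, ?_, ?_⟩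
  · refine ⟨mem_chart_source _ p, ?_⟩
    have h := K.map_source hK0
    rw [hK, hG0] at h
    exact h
  · have h1 : HasMFDerivAt 𝓘(ℝ, EuclideanSpace ℝ (Fin (2 * n + 1))) 𝓘(ℝ, ℝ)
        (fun y => ℓ (K.symm y)) x₀ ℓ :=
      ((ℓ.hasFDerivAt.comp x₀ hKs).congr_fderiv (ℓ.comp_id)).hasMFDerivAt
    have h2 := ((contMDiffAt_extChartAt (I := 𝓡 (2 * n + 1)) (n := 1)
      (x := p)).mdifferentiableAt (by simp)).hasMFDerivAt
    refine (h1.comp p h2).congr_mfderiv ?_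
    refine ContinuousLinearMap.ext fun v => ?_
    exact ηInChart_mfderiv_extChartAt p v
  · intro v hv
    obtain ⟨-, h2, h3⟩ := hWspec v (hΦt v hv)
    obtain ⟨g0, g1, g2, g3⟩ := hγ _ h2
    rw [hΦsymm, h3, ← reebFlow_add, neg_add_cancel, reebFlow_zero]
    obtain ⟨F, hF, hFe⟩ := S.exists_mem_phiSymmetries_of_isPhiGeodesicOn hS ht₁
      (S.isPhiGeodesicOn_of_horizontal hS.paraSasakian ha g3 g2 (by
        rw [g0, g1]
        exact hℓP v))
    rw [g0] at hFe
    exact ⟨F, Subgroup.subset_closure hF, hFe⟩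
  · intro v hv t hvt
    rw [hΦsymm, hΦsymm, (hWspec _ (hΦt _ hv)).2.2, (hWspec _ (hΦt _ hvt)).2.2, hPadd,
      ← reebFlow_add, map_add, map_smul, hℓz, smul_eq_mul, mul_one, add_comm]

end ParaContactMetricStructure

/-! ### Transitivity -/

namespace ParaContactMetricStructure

variable {n : ℕ} {M : Type*} [TopologicalSpace M]
  [ChartedSpace (EuclideanSpace ℝ (Fin (2 * n + 1))) M] [IsManifold (𝓡 (2 * n + 1)) ∞ M]
  {S : ParaContactMetricStructure n M} (hS : S.IsPhiSymmetric)

/-- Suppose the Reeb flow carries `yᵢ`, in time `-τᵢ`, to points related to `p`. If `y₁` and `y₂`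
are related, then `τ₂ - τ₁` is a period of `p`. -/
theorem sub_mem_periods [T2Space M] {p y₁ y₂ : M} {τ₁ τ₂ : ℝ}
    (h₁ : S.Related p (reebFlow hS (-τ₁) y₁)) (h₂ : S.Related p (reebFlow hS (-τ₂) y₂))
    (h : S.Related y₁ y₂) : τ₂ - τ₁ ∈ periods hS p := by
  have h3 := h₂.reebFlow hS (τ₂ - τ₁)
  rw [← reebFlow_add, show τ₂ - τ₁ + -τ₂ = -τ₁ by ring] at h3
  exact h₁.trans ((h.reebFlow hS (-τ₁)).trans h3.symm)

/-- If the periods at `p` are not all of `ℝ`, the function `ℓ ∘ Φ` given by adapted coordinates at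
`p` is a local primitive of the contact form. Its values at related points differ by a period, so by
the intermediate value theorem it is constant along the `φ`-geodesics through any point `y`, and it
increases with unit speed along the Reeb flow. Hence near `y` it agrees, up to a constant, with the
analogous function of the adapted coordinates at `y`, whose differential at `y` is `η`. -/
theorem hasMFDerivAt_of_periods_ne_top [T2Space M] {p : M} (hT : periods hS p ≠ ⊤)
    {Φ : OpenPartialHomeomorph M (EuclideanSpace ℝ (Fin (2 * n + 1)))}
    {ℓ : EuclideanSpace ℝ (Fin (2 * n + 1)) →L[ℝ] ℝ} {z : EuclideanSpace ℝ (Fin (2 * n + 1))}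
    (hℓz : ℓ z = 1) (hrel : ∀ v ∈ Φ.target, S.Related p (reebFlow hS (-ℓ v) (Φ.symm v)))
    (hflow : ∀ v ∈ Φ.target, ∀ t : ℝ, v + t • z ∈ Φ.target →
      Φ.symm (v + t • z) = reebFlow hS t (Φ.symm v)) {y : M} (hy : y ∈ Φ.source) :
    HasMFDerivAt (𝓡 (2 * n + 1)) 𝓘(ℝ, ℝ) (fun x => ℓ (Φ x)) y (S.η y) := by
  obtain ⟨Φ', ℓ', z', hℓz', hy', hΦ'y, hder, hrel', hflow'⟩ := exists_adapted_coordinates hS y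
  have hy0 : Φ'.symm 0 = y := by rw [← hΦ'y, Φ'.left_inv hy']
  have h0t : (0 : EuclideanSpace ℝ (Fin (2 * n + 1))) ∈ Φ'.target := by
    rw [← hΦ'y]
    exact Φ'.map_source hy'
  have hrelΦ : ∀ x ∈ Φ.source, S.Related p (reebFlow hS (-ℓ (Φ x)) x) := fun x hx => by
    have := hrel _ (Φ.map_source hx)
    rwa [Φ.left_inv hx] at this
  have hsymm_cont : ContinuousAt Φ'.symm 0 := Φ'.continuousAt_symm h0t
  -- a ball of coordinates at `y` inside the coordinates at `p`
  obtain ⟨ρ, hρ, hball⟩ : ∃ ρ > 0, ∀ w ∈ ball (0 : EuclideanSpace ℝ (Fin (2 * n + 1))) ρ,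
      w ∈ Φ'.target ∧ Φ'.symm w ∈ Φ.source := by
    refine Metric.eventually_nhds_iff_ball.1 (Filter.Eventually.and
      (Φ'.open_target.mem_nhds h0t) (hsymm_cont.tendsto.eventually ?_))
    rw [hy0]
    exact Φ.open_source.mem_nhds hy
  -- `ℓ ∘ Φ` increases with unit speed along the Reeb flow
  have hadd : ∀ᶠ q : M × ℝ in 𝓝 (y, 0), ℓ (Φ (reebFlow hS q.2 q.1)) = ℓ (Φ q.1) + q.2 := by
    have hc : Filter.Tendsto (fun q : M × ℝ => Φ q.1 + q.2 • z) (𝓝 (y, 0)) (𝓝 (Φ y)) := by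
      have h1 : ContinuousAt (fun q : M × ℝ => Φ q.1) (y, 0) :=
        ContinuousAt.comp (g := Φ) (Φ.continuousAt hy) continuousAt_fst
      have h2 : ContinuousAt (fun q : M × ℝ => Φ q.1 + q.2 • z) (y, 0) :=
        h1.add (continuousAt_snd.smul continuousAt_const)
      simpa using h2.tendsto
    filter_upwards [hc.eventually (Φ.open_target.mem_nhds (Φ.map_source hy)),
      (continuousAt_fst (p := ((y, 0) : M × ℝ))).tendsto.eventually (Φ.open_source.mem_nhds hy)]
      with q hq1 hq2
    have h3 := hflow _ (Φ.map_source hq2) q.2 hq1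
    rw [Φ.left_inv hq2] at h3
    rw [← h3, Φ.right_inv hq1, map_add, map_smul, hℓz, smul_eq_mul, mul_one]
  -- `ℓ ∘ Φ` is constant along the `φ`-geodesics through `y`
  have hconst : ∀ w ∈ ball (0 : EuclideanSpace ℝ (Fin (2 * n + 1))) ρ, ℓ' w = 0 →
      ℓ (Φ (Φ'.symm w)) = ℓ (Φ y) := by
    intro w hw hw0
    have hsw : ∀ s ∈ Icc (0 : ℝ) 1, s • w ∈ ball (0 : EuclideanSpace ℝ (Fin (2 * n + 1))) ρ := by
      intro s hs
      rw [mem_ball_zero_iff] at hw ⊢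
      rw [norm_smul, Real.norm_of_nonneg hs.1]
      nlinarith [hs.2, norm_nonneg w]
    set k : ℝ → ℝ := fun s => ℓ (Φ (Φ'.symm (s • w))) - ℓ (Φ y) with hk
    have hk0 : k 0 = 0 := by simp only [hk, zero_smul, hy0, sub_self]
    have hkT : ∀ s ∈ Icc (0 : ℝ) 1, k s ∈ periods hS p := by
      intro s hs
      obtain ⟨h1, h2⟩ := hball _ (hsw s hs)
      refine sub_mem_periods hS (hrelΦ _ hy) (hrelΦ _ h2) ?_
      have h3 := hrel' _ h1
      rwa [map_smul, hw0, smul_zero, neg_zero, reebFlow_zero] at h3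
    have hkc : ContinuousOn k (Icc 0 1) := by
      intro s hs
      obtain ⟨h1, h2⟩ := hball _ (hsw s hs)
      have c1 : ContinuousAt (fun s : ℝ => Φ'.symm (s • w)) s :=
        ContinuousAt.comp (g := Φ'.symm) (Φ'.continuousAt_symm h1)
          (continuousAt_id.smul continuousAt_const)
      have c2 : ContinuousAt (fun s : ℝ => Φ (Φ'.symm (s • w))) s :=
        ContinuousAt.comp (g := Φ) (Φ.continuousAt h2) c1
      exact ((ℓ.continuous.continuousAt.comp c2).sub continuousAt_const).continuousWithinAt
    have hk1 : k 1 = 0 := by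
      by_contra hne
      rcases lt_or_gt_of_ne hne with hneg | hpos
      · refine hT (addSubgroup_eq_top_of_Icc_subset (a := -k 1) (by linarith) fun τ hτ => ?_)
        obtain ⟨s, hs, hks⟩ := intermediate_value_Icc' zero_le_one hkc
          (show -τ ∈ Icc (k 1) (k 0) from ⟨by linarith [hτ.2], by rw [hk0]; linarith [hτ.1]⟩)
        have := (periods hS p).neg_mem (hkT s hs)
        rwa [hks, neg_neg] at this
      · refine hT (addSubgroup_eq_top_of_Icc_subset hpos fun τ hτ => ?_)
        obtain ⟨s, hs, hks⟩ := intermediate_value_Icc zero_le_one hkc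
          (show τ ∈ Icc (k 0) (k 1) from ⟨by rw [hk0]; exact hτ.1, hτ.2⟩)
        have := hkT s hs
        rwa [hks] at this
    have := sub_eq_zero.1 hk1
    rwa [one_smul] at this
  have hev : (fun x => ℓ (Φ x)) =ᶠ[𝓝 y] fun x => ℓ (Φ y) + ℓ' (Φ' x) := by
    have c1 : ContinuousAt (fun x => Φ' x - ℓ' (Φ' x) • z') y :=
      (Φ'.continuousAt hy').sub (((ℓ'.continuous.continuousAt).comp
        (Φ'.continuousAt hy')).smul continuousAt_const)
    have c2 : Filter.Tendsto (fun x => Φ' x - ℓ' (Φ' x) • z') (𝓝 y) (𝓝 0) := by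
      have := c1.tendsto
      rwa [hΦ'y, map_zero, zero_smul, sub_zero] at this
    have c3 : Filter.Tendsto (fun x => (Φ'.symm (Φ' x - ℓ' (Φ' x) • z'), ℓ' (Φ' x))) (𝓝 y)
        (𝓝 (y, 0)) := by
      have h1 := hsymm_cont.tendsto.comp c2
      rw [hy0] at h1
      have h2 := (ℓ'.continuous.continuousAt.comp (Φ'.continuousAt hy')).tendsto
      simp only [Function.comp, hΦ'y, map_zero] at h2
      exact h1.prodMk_nhds h2
    filter_upwards [Φ'.open_source.mem_nhds hy', c2.eventually (ball_mem_nhds _ hρ),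
      c3.eventually hadd] with x hx1 hx2 hx3
    have h1 := hflow' _ (hball _ hx2).1 (ℓ' (Φ' x)) (by
      rw [sub_add_cancel]
      exact Φ'.map_source hx1)
    rw [sub_add_cancel, Φ'.left_inv hx1] at h1
    rw [← h1, hconst _ hx2 (by simp [hℓz'])] at hx3
    exact hx3
  have hsum := (hasMFDerivAt_const (I := 𝓡 (2 * n + 1)) (ℓ (Φ y)) y).add hder
  exact (hsum.congr_of_eventuallyEq hev).congr_mfderiv (zero_add _)

/-- The contact form has no local primitive: otherwise `dη = 0`, so `g(·, φ ·) = 0` and `φ = 0` at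
`p`, and `φ² = Id - η ⊗ ξ` forces the dimension to be `1`. -/
theorem not_hasMFDerivAt_η [T2Space M] (hn : 1 ≤ n) (p : M) (f : M → ℝ) :
    ¬ ∀ᶠ y in 𝓝 p, HasMFDerivAt (𝓡 (2 * n + 1)) 𝓘(ℝ, ℝ) f y (S.η y) := by
  intro hf
  have hp : extChartAt (𝓡 (2 * n + 1)) p p ∈ (extChartAt (𝓡 (2 * n + 1)) p).target :=
    mem_extChartAt_target p
  have htgt := (isOpen_extChartAt_target (I := 𝓡 (2 * n + 1)) p).mem_nhds hp
  have hc : Filter.Tendsto (extChartAt (𝓡 (2 * n + 1)) p).symm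
      (𝓝 (extChartAt (𝓡 (2 * n + 1)) p p)) (𝓝 p) := by
    have := (contMDiffAt_chart_symm hp).continuousAt.tendsto
    rwa [extChartAt_to_inv] at this
  have hd : ∀ᶠ z in 𝓝 (extChartAt (𝓡 (2 * n + 1)) p p),
      HasFDerivAt (f ∘ (extChartAt (𝓡 (2 * n + 1)) p).symm) (S.ηInChart p z) z := by
    filter_upwards [hc.eventually hf, htgt] with z hz1 hz2
    exact (hz1.comp z
      ((contMDiffAt_chart_symm hz2).mdifferentiableAt (by simp)).hasMFDerivAt).hasFDerivAt
  have hη := ((S.contDiffAt_ηInChart hp).differentiableAt (by simp)).hasFDerivAt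
  have hg : ∀ u v, S.g.inChartForm p (extChartAt (𝓡 (2 * n + 1)) p p) u
      (S.φInChart p (extChartAt (𝓡 (2 * n + 1)) p p) v) = 0 := by
    intro u v
    have h1 := S.fderiv_ηInChart_sub hp u v
    rw [second_derivative_symmetric_of_eventually hd hη u v, sub_self] at h1
    linarith
  have hφ : ∀ v, S.φInChart p (extChartAt (𝓡 (2 * n + 1)) p p) v = 0 := fun v =>
    S.g.inChartForm_nondegenerate hp fun w => by rw [S.g.inChartForm_symm]; exact hg w v
  have hrank := finrank_le_one (R := ℝ) (S.ξInChart p (extChartAt (𝓡 (2 * n + 1)) p p)) fun v => by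
    refine ⟨S.ηInChart p (extChartAt (𝓡 (2 * n + 1)) p p) v, ?_⟩
    have h1 := S.φInChart_φInChart hp v
    rw [hφ] at h1
    exact (sub_eq_zero.1 h1.symm).symm
  rw [finrank_euclideanSpace_fin] at hrank
  omega

/-- Every translation along the Reeb trajectory of `p` is realized by the group generated by the
symmetries. -/
theorem periods_eq_top [T2Space M] (hn : 1 ≤ n) (p : M) : periods hS p = ⊤ := by
  by_contra hT
  obtain ⟨Φ, ℓ, z, hℓz, hp, -, -, hrel, hflow⟩ := exists_adapted_coordinates hS p
  refine not_hasMFDerivAt_η (S := S) hn p (fun x => ℓ (Φ x)) ?_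
  filter_upwards [Φ.open_source.mem_nhds hp] with y hy
  exact hasMFDerivAt_of_periods_ne_top hS hT hℓz hrel hflow hy

include hS in
/-- The orbits of the group generated by the symmetries contain neighbourhoods of their points. -/
theorem eventually_related [T2Space M] (hn : 1 ≤ n) (p : M) : ∀ᶠ y in 𝓝 p, S.Related p y := by
  obtain ⟨Φ, ℓ, z, -, hp, -, -, hrel, -⟩ := exists_adapted_coordinates hS p
  filter_upwards [Φ.open_source.mem_nhds hp] with y hy
  have h1 := hrel _ (Φ.map_source hy)
  rw [Φ.left_inv hy] at h1
  have h2 : -ℓ (Φ y) ∈ periods hS y := by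
    rw [periods_eq_top hS hn y]
    exact AddSubgroup.mem_top _
  exact h1.trans (Related.symm h2)

include hS in
theorem related_of_connectedSpace [T2Space M] [ConnectedSpace M] (hn : 1 ≤ n) (p q : M) :
    S.Related p q := by
  have hopen : IsOpen {y | S.Related p y} := isOpen_iff_mem_nhds.2 fun y hy => by
    filter_upwards [eventually_related hS hn y] with x hx using Related.trans hy hx
  have hclosed : IsClosed {y | S.Related p y} := isOpen_compl_iff.1 <|
    isOpen_iff_mem_nhds.2 fun y hy => by
      filter_upwards [eventually_related hS hn y] with x hx hpx
      exact hy (Related.trans hpx hx.symm)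
  have huniv := IsClopen.eq_univ ⟨hclosed, hopen⟩ ⟨p, Related.refl p⟩
  exact huniv.ge (mem_univ q)

end ParaContactMetricStructure

end ParaSasaki

theorem mainTheorem2 (n : ℕ) (hn : 1 ≤ n) (M : Type*) [TopologicalSpace M]
    [ChartedSpace (EuclideanSpace ℝ (Fin (2 * n + 1))) M] [IsManifold (𝓡 (2 * n + 1)) ∞ M]
    [T2Space M] [SecondCountableTopology M] [ConnectedSpace M]
    (S : ParaSasaki.ParaContactMetricStructure n M) (hS : S.IsPhiSymmetric) :
    ∀ p q : M, ∃ F ∈ (Subgroup.closure S.phiSymmetries).topologicalClosure,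
      (F : M ≃ₜ M) p = q := by
  intro p q
  obtain ⟨F, hF, hFpq⟩ :=
    ParaSasaki.ParaContactMetricStructure.related_of_connectedSpace hS hn p q
  exact ⟨F, Subgroup.le_topologicalClosure _ hF, hFpq⟩
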